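/- **Setting.** Let $\mathcal S,\mathcal A$ be finite sets with $|\mathcal S|=S$, $|\mathcal A|=A$, and consider an episodic MDP with horizon $H$, fixed known initial state $s_1$ and unknown transition kernels $P_h(s'\mid s,a)$, $h\in[H]$. A policy $\pi=(\pi_1,\dots,\pi_H)$ consists of maps $\pi_h:\mathcal S\to\Delta(\mathcal A)$. Let $d_h^\pi(s,a)=\mathbb P_\pi(s_h=s,a_h=a)$; for a reward function $r=(r_h)_{h\in[H]}$ with $r_h:\mathcal S\times\mathcal A\to[0,1]$ let $V^\pi(r)=\mathbb E_\pi\big[\sum_{h=1}^H r_h(s_h,a_h)\big]$ and $V^\star(r)=\sup_\pi V^\pi(r)$. A policy $\pi$ is $\epsilon$-optimal for $r$ if $V^\pi(r)\ge V^\star(r)-\epsilon$. Put $\mathcal S_1=\{s_1\}$ and $\mathcal S_h=\mathcal S$ for $2\le h\le H$, and let $$d_m=\min_{h\in[H]}\ \sup_\pi\ \min_{(s,a)\in\mathcal S_h\times\mathcal A} d_h^\pi(s,a).$$ Let $\Pi_0$ be the set of all deterministic policies and $\Delta(\Pi_0)$ the set of mixtures of them (a mixture draws one policy at the start of each episode).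 **Estimators.** Let $\mathcal D$ be a finite family of trajectories $(s_h^n,a_h^n)_{h\in[H]}$, let $\phi(s,a)=e_{(s,a)}\in\mathbb R^{SA}$, $\Lambda_h=I+\sum_n\phi(s_h^n,a_h^n)\phi(s_h^n,a_h^n)^\top$, and for $V:\mathcal S\to\mathbb R$ let $\bar w_h(V)=\Lambda_h^{-1}\sum_n\phi(s_h^n,a_h^n)V(s_{h+1}^n)$. Write $(x)_{[0,B]}=\max\{0,\min\{x,B\}\}$. - For $\pi\in\Pi_0$, $\widehat V^\pi(r)=V_1(s_1)$, where $V_{H+1}=0$ and $V_h(s)=\big(\phi(s,\pi_h(s))^\top\bar w_h(V_{h+1})+r_h(s,\pi_h(s))\big)_{[0,H]}$ for $h=H,\dots,1$ (with $\bar w_H(V_{H+1})=0$). - For $\pi\in\Pi_0$, $\widehat d_h^\pi(s,a)=V_1(s_1)$, where $V_h(s')=\mathbf 1[(s',\pi_h(s'))=(s,a)]$ and $V_{j}(s')=\big(\phi(s',\pi_{j}(s'))^\top\bar w_{j}(V_{j+1})\big)_{[0,1]}$ for $j=h-1,\dots,1$. For a mixture $\pi\in\Delta(\Pi_0)$ taking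 $\pi_i$ with probability $p_i$, $\widehat d_h^\pi=\sum_i p_i\widehat d_h^{\pi_i}$. **Exploration.** Given $\epsilon,\delta$ and constants $C_1,C_2,C_3$, set $\iota=\log\frac{SAH}{\epsilon\delta}$, $\bar\epsilon=\frac{C_1\epsilon}{H^2\sqrt S\,\iota}$ and $N=\big\lceil C_2SA\iota/\bar\epsilon^2\big\rceil$. For $h=1,\dots,H$, using all trajectories collected so far, let $$\pi_h\in\operatorname*{argmin}_{\substack{\pi\in\Delta(\Pi_0):\ \widehat d_h^\pi(s,a)\ge C_3H\sqrt S\,\bar\epsilon\,\iota\\ \forall (s,a)\in\mathcal S_h\times\mathcal A}}\ \max_{\widehat\pi\in\Pi_0}\sum_{(s,a)\in\mathcal S_h\times\mathcal A}\frac{\widehat d_h^{\widehat\pi}(s,a)}{\widehat d_h^\pi(s,a)}$$ (ties are broken arbitrarily, and $\pi_h$ is arbitrary if there is no minimizer), and deploy $\pi_h$ for $N$ episodes. **Planning.** From the complete dataset and a reward function $r$, return any $\widehat\pi\in\operatorname{argmax}_{\pi\in\Pi_0}\widehat V^\pi(r)$. **Theorem.** There are universal constants $C_1,C_2,C_3,C_4,C>0$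 such that the following holds for all finite $\mathcal S,\mathcal A$, all $H$, every MDP as above with $d_m>0$, and all $\delta\in(0,1)$ and $0<\epsilon\le\frac{Hd_m}{C_4SA}$. With probability at least $1-\delta$ over the exploration, simultaneously for every reward function $r$ with values in $[0,1]$, every policy that planning may return is $\epsilon$-optimal for $r$. The exploration uses $H$ deployments, each of the same number $N$ of trajectories fixed in advance, and in total $$HN\ \le\ C\,\frac{S^2AH^5}{\epsilon^2}\,\log^3\!\Big(\frac{SAH}{\epsilon\delta}\Big)=\widetilde O\Big(\frac{S^2AH^5}{\epsilon^2}\Big)$$ trajectories. -/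

import Mathlib

open scoped Matrix

noncomputable section

namespace TabularRF

/-- A finite-horizon tabular MDP with non-stationary transitions and a fixed initial state.
Layers are `0, …, H - 1`; `P h s a s'` is the probability of moving from `s` to `s'` when
action `a` is played at layer `h`. Rewards are not part of the model (reward-free setting). -/
structure MDP (S A : Type*) [Fintype S] (H : ℕ) where
  P : Fin H → S → A → S → ℝ
  P_mem : ∀ h s a, P h s a ∈ stdSimplex ℝ S
  s₁ : S

/-- A reward-free trajectory `(s_h, a_h)_h`. -/
abbrev Traj (S A : Type*) (H : ℕ) := Fin H → S × A

/-- Deterministic policies. The whole type is the policy set `Π₀`. -/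
abbrev DetPolicy (S A : Type*) (H : ℕ) := Fin H → S → A

/-- (Markov, randomized) policies. -/
abbrev Policy (S A : Type*) [Fintype A] (H : ℕ) :=
  {π : Fin H → S → A → ℝ // ∀ h s, π h s ∈ stdSimplex ℝ A}

/-- `Δ(Π₀)`: mixtures of deterministic policies (one policy is drawn per episode). -/
abbrev Mixture (S A : Type*) [Fintype S] [DecidableEq S] [Fintype A] (H : ℕ) :=
  stdSimplex ℝ (DetPolicy S A H)

/-- Reward functions: expected immediate rewards. -/
abbrev Reward (S A : Type*) (H : ℕ) := Fin H → S → A → ℝ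

/-- Valid rewards take values in `[0,1]`. -/
def IsValidReward {S A : Type*} {H : ℕ} (r : Reward S A H) : Prop :=
  ∀ h s a, r h s a ∈ Set.Icc (0 : ℝ) 1

section Basic

variable {S A : Type*} [Fintype S] [DecidableEq S] [Fintype A] [DecidableEq A] {H : ℕ}

/-- A deterministic policy as a (degenerate) randomized one. -/
def DetPolicy.toPolicy (π : DetPolicy S A H) : Policy S A H :=
  ⟨fun h s => Pi.single (π h s) 1, fun h s => single_mem_stdSimplex ℝ (π h s)⟩

/-- Probability of the state of `τ` at layer `h` given the previous state and action of `τ`. -/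
def MDP.stateProb (M : MDP S A H) (τ : Traj S A H) (h : Fin H) : ℝ :=
  if h.val = 0 then (if (τ h).1 = M.s₁ then 1 else 0)
  else
    let g : Fin H := ⟨h.val - 1, lt_of_le_of_lt (Nat.sub_le _ _) h.isLt⟩
    M.P g (τ g).1 (τ g).2 (τ h).1

/-- `ℙ_π(τ)`. -/
def MDP.trajProb (M : MDP S A H) (π : Policy S A H) (τ : Traj S A H) : ℝ :=
  ∏ h : Fin H, M.stateProb τ h * π.1 h (τ h).1 (τ h).2

/-- Law of one trajectory of a mixture of deterministic policies. -/
def MDP.mixTrajProb (M : MDP S A H) (w : Mixture S A H) (τ : Traj S A H) : ℝ :=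
  ∑ π : DetPolicy S A H, w.1 π * M.trajProb (DetPolicy.toPolicy π) τ

/-- Occupancy measure `d_h^π(s,a) = ℙ_π(s_h = s, a_h = a)`. -/
def MDP.occ (M : MDP S A H) (π : Policy S A H) (h : Fin H) (x : S × A) : ℝ :=
  ∑ τ : Traj S A H, if τ h = x then M.trajProb π τ else 0

/-- `V^π(r) = 𝔼_π[∑_h r_h(s_h, a_h)]`. -/
def MDP.value (M : MDP S A H) (π : Policy S A H) (r : Reward S A H) : ℝ :=
  ∑ τ : Traj S A H, M.trajProb π τ * ∑ h : Fin H, r h (τ h).1 (τ h).2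

/-- `V⋆(r)`. -/
def MDP.optValue (M : MDP S A H) (r : Reward S A H) : ℝ :=
  ⨆ π : Policy S A H, M.value π r

/-- `π` is `ε`-optimal with respect to `r`. -/
def MDP.IsEpsOptimal (M : MDP S A H) (ε : ℝ) (r : Reward S A H) (π : Policy S A H) : Prop :=
  M.optValue r - ε ≤ M.value π r

/-- State-action pairs of layer `h`. The initial state is fixed, so the only state of the first
layer is `s₁`; every other layer has all of `S`. -/
def layerPairs (s₁ : S) (h : Fin H) : Finset (S × A) :=
  if h.val = 0 then {s₁} ×ˢ Finset.univ else Finset.univ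

/-- `d_m = min_h sup_π min_{s,a} d_h^π(s,a)`, with `(s,a)` among the pairs of layer `h`. -/
def MDP.dm (M : MDP S A H) : ℝ :=
  ⨅ h : Fin H, ⨆ π : Policy S A H, ⨅ x : layerPairs (A := A) M.s₁ h, M.occ π h x.1

end Basic

section Estimation

variable {S A : Type*} [Fintype S] [DecidableEq S] [Fintype A] [DecidableEq A] {H : ℕ}
variable {I : Type*} [Fintype I]

/-- Truncation `(x)_{[0,B]}`. -/
def clip (B x : ℝ) : ℝ := max 0 (min x B)

/-- Canonical feature map `φ(s,a) = e_{(s,a)}`. -/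
def feature (x : S × A) : S × A → ℝ := Pi.single x 1

/-- `Λ_h = I + ∑_n φ(s_h^n,a_h^n) φ(s_h^n,a_h^n)ᵀ`. -/
def covMatrix (D : I → Traj S A H) (h : Fin H) : Matrix (S × A) (S × A) ℝ :=
  1 + ∑ n, Matrix.vecMulVec (feature (D n h)) (feature (D n h))

/-- `V(s_{h+1})` along the trajectory `τ`; after the last layer the continuation value is `0`. -/
def nextValue (τ : Traj S A H) (h : Fin H) (V : S → ℝ) : ℝ :=
  if hh : h.val + 1 < H then V (τ ⟨h.val + 1, hh⟩).1 else 0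

/-- `w̄_h = Λ_h⁻¹ ∑_n φ(s_h^n,a_h^n) V(s_{h+1}^n)`. -/
def lsviWeight (D : I → Traj S A H) (h : Fin H) (V : S → ℝ) : S × A → ℝ :=
  (covMatrix D h)⁻¹ *ᵥ ∑ n, nextValue (D n) h V • feature (D n h)

/-- `V_j` of `EstimateER` (estimation of `𝔼_π r(s_h,a_h)`, reward bound `B`), for `j ≤ h`:
`V_h(s) = r(s, π_h(s))` and `V_j(s) = (φ(s, π_j(s))ᵀ w̄_j)_{[0,B]}` for `j < h`. -/
def erV (D : I → Traj S A H) (π : DetPolicy S A H) (r : S → A → ℝ) (B : ℝ) (h : Fin H)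
    (j : ℕ) : S → ℝ :=
  if hj : j < h.val then
    let g : Fin H := ⟨j, hj.trans h.isLt⟩
    let w := lsviWeight D g (erV D π r B h (j + 1))
    fun s => clip B (feature (s, π g s) ⬝ᵥ w)
  else fun s => r s (π h s)
termination_by h.val - j

/-- Output of `EstimateER`. -/
def estimateER (D : I → Traj S A H) (s₁ : S) (π : DetPolicy S A H) (r : S → A → ℝ) (B : ℝ)
    (h : Fin H) : ℝ :=
  erV D π r B h 0 s₁

/-- `V_j` of `EstimateV`: `V_H = 0` (layers start at `0`) and
`V_j(s) = (φ(s, π_j(s))ᵀ w̄_j + r_j(s, π_j(s)))_{[0,H]}`. -/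
def evV (D : I → Traj S A H) (π : DetPolicy S A H) (r : Reward S A H) (j : ℕ) : S → ℝ :=
  if hj : j < H then
    let w := lsviWeight D ⟨j, hj⟩ (evV D π r (j + 1))
    fun s => clip H (feature (s, π ⟨j, hj⟩ s) ⬝ᵥ w + r ⟨j, hj⟩ s (π ⟨j, hj⟩ s))
  else 0
termination_by H - j

/-- Output `V̂^π(r)` of `EstimateV`. -/
def estimateV (D : I → Traj S A H) (s₁ : S) (π : DetPolicy S A H) (r : Reward S A H) : ℝ :=
  evV D π r 0 s₁

/-- `d̂_h^π(s,a)`: `EstimateER` applied to the indicator reward of `(s,a)`, with bound `1`. -/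
def estOcc (D : I → Traj S A H) (s₁ : S) (h : Fin H) (π : DetPolicy S A H) (x : S × A) : ℝ :=
  estimateER D s₁ π (fun s a => if (s, a) = x then 1 else 0) 1 h

/-- `d̂_h^w(s,a)` for a mixture `w`: the mixture of the estimates. -/
def estOccMix (D : I → Traj S A H) (s₁ : S) (h : Fin H) (w : Mixture S A H) (x : S × A) : ℝ :=
  ∑ π : DetPolicy S A H, w.1 π * estOcc D s₁ h π x

/-- The constraint `d̂_h^w(s,a) ≥ θ` for all `(s,a)`. -/
def IsFeasible (D : I → Traj S A H) (s₁ : S) (θ : ℝ) (h : Fin H) (w : Mixture S A H) : Prop :=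
  ∀ x ∈ layerPairs s₁ h, θ ≤ estOccMix D s₁ h w x

/-- `max_{π̂ ∈ Π₀} ∑_{s,a} d̂_h^π̂(s,a) / d̂_h^w(s,a)`. -/
def designObjective (D : I → Traj S A H) (s₁ : S) (h : Fin H) (w : Mixture S A H) : ℝ :=
  ⨆ π : DetPolicy S A H, ∑ x ∈ layerPairs s₁ h, estOcc D s₁ h π x / estOccMix D s₁ h w x

/-- `w` solves the constrained occupancy-ratio design problem of layer `h`. -/
def IsDesignSolution (D : I → Traj S A H) (s₁ : S) (θ : ℝ) (h : Fin H) (w : Mixture S A H) :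
    Prop :=
  IsFeasible D s₁ θ h w ∧
    ∀ w', IsFeasible D s₁ θ h w' → designObjective D s₁ h w ≤ designObjective D s₁ h w'

/-- Planning: `π̂ ∈ argmax_{π ∈ Π₀} V̂^π(r)` (any maximizer may be returned). -/
def IsPlanningOutput (D : I → Traj S A H) (s₁ : S) (r : Reward S A H) (π' : DetPolicy S A H) :
    Prop :=
  ∀ π : DetPolicy S A H, estimateV D s₁ π r ≤ estimateV D s₁ π' r

end Estimation

section Deployment

/-- An exploration procedure with `m` deployments of exactly `N` trajectories each, `m` and `N`
being fixed in advance: the mixture run in deployment `k` is a function of the trajectories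
collected in the deployments before `k`. -/
structure Scheme (S A : Type*) [Fintype S] [DecidableEq S] [Fintype A] (H m N : ℕ) where
  policy : (k : Fin m) → (Fin k.val → Fin N → Traj S A H) → Mixture S A H

variable {S A : Type*} [Fintype S] [DecidableEq S] [Fintype A] [DecidableEq A] {H m N : ℕ}

/-- The number of deployments. -/
def Scheme.deployments (_alg : Scheme S A H m N) : ℕ := m

/-- The total number of trajectories collected. -/
def Scheme.trajectories (_alg : Scheme S A H m N) : ℕ := Fintype.card (Fin m × Fin N)

/-- The mixture run in deployment `k` when the complete dataset is `D`. -/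
def Scheme.deployed (alg : Scheme S A H m N) (D : Fin m → Fin N → Traj S A H) (k : Fin m) :
    Mixture S A H :=
  alg.policy k (fun i n => D ⟨i.val, i.isLt.trans k.isLt⟩ n)

/-- Probability of collecting exactly the dataset `D` in the MDP `M`. -/
def Scheme.dataProb (alg : Scheme S A H m N) (M : MDP S A H)
    (D : Fin m → Fin N → Traj S A H) : ℝ :=
  ∏ k : Fin m, ∏ n : Fin N, M.mixTrajProb (alg.deployed D k) (D k n)

/-- Probability of an event about the collected dataset. -/
def Scheme.prob (alg : Scheme S A H m N) (M : MDP S A H)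
    (E : Set (Fin m → Fin N → Traj S A H)) : ℝ :=
  ∑ D : Fin m → Fin N → Traj S A H, E.indicator (alg.dataProb M) D

/-- A dataset of several deployments as one family of trajectories. -/
def pool {m : ℕ} (D : Fin m → Fin N → Traj S A H) : Fin m × Fin N → Traj S A H :=
  fun p => D p.1 p.2

/-- Layer-by-layer exploration with `H` deployments: deployment `h` runs a solution of the
design problem of layer `h` for the data collected so far, whenever a solution exists. Ties (and
the choice made when there is no solution) are arbitrary. -/
def Scheme.IsLayerwiseExploration (alg : Scheme S A H H N) (s₁ : S) (θ : ℝ) : Prop :=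
  ∀ (h : Fin H) (D : Fin h.val → Fin N → Traj S A H),
    (∃ w, IsDesignSolution (pool D) s₁ θ h w) →
      IsDesignSolution (pool D) s₁ θ h (alg.policy h D)

end Deployment

/-- `ι = log(dH / (εδ))` with `d = SA`. -/
def iota (S A H : ℕ) (ε δ : ℝ) : ℝ := Real.log ((S : ℝ) * A * H / (ε * δ))

/-- `ε̄ = C₁ ε / (H² √S ι)`. -/
def epsBar (C₁ : ℝ) (S A H : ℕ) (ε δ : ℝ) : ℝ :=
  C₁ * ε / ((H : ℝ) ^ 2 * Real.sqrt S * iota S A H ε δ)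

/-- `N = C₂ S A ι / ε̄²` trajectories per deployment, rounded up. -/
def batchSize (C₁ C₂ : ℝ) (S A H : ℕ) (ε δ : ℝ) : ℕ :=
  ⌈C₂ * S * A * iota S A H ε δ / epsBar C₁ S A H ε δ ^ 2⌉₊

/-- The lower bound `C₃ H √S ε̄ ι` in the constraint of the design problem. -/
def threshold (C₁ C₃ : ℝ) (S A H : ℕ) (ε δ : ℝ) : ℝ :=
  C₃ * H * Real.sqrt S * epsBar C₁ S A H ε δ * iota S A H ε δ

end TabularRF

end

/-! Write `η = ε / H` for the threshold of the design problems. The error of the clipped dynamic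
program for a policy is at most `H` times the value of the local regression errors under that
policy, and the local error at layer `j` and pair `x` is governed by the deviations
`∑ n, (1_T (s_{j+1}^n) - P_j(T | x))` over the visits to `x`, for sets `T` of states. An exponential
supermartingale with one choice (pair, set of next states, temperature `l_j`) per layer bounds
`∑ j, (l_j * deviation_j - l_j ^ 2 * visits_j)` by `H * L` simultaneously for all choices, hence the
sum over the layers of the errors rather than each of them separately.

First-order optimality of the product-maximizing mixture `w` gives `∑ x, d^π x / d^w x ≤ S * A` for
every `π`, so every solution of the design problem covers its layer with constant `3 * S * A`, as
long as the occupancy estimates are accurate. By Cauchy-Schwarz the accumulated local error is then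
at most `6 * H * √(3 * S * A * L / N) ≤ η / 8`, which makes the estimates of the next layer accurate
again. Induction over the layers covers them all, and the same bound for the complete dataset makes
planning `ε`-optimal. -/

noncomputable section

namespace TabularRF

section Simplex

variable {ι : Type*} [Fintype ι] {p : ι → ℝ}

theorem sum_mul_mem_Icc_of_mem_stdSimplex (hp : p ∈ stdSimplex ℝ ι) {f : ι → ℝ} {a b : ℝ}
    (hf : ∀ i, f i ∈ Set.Icc a b) : ∑ i, p i * f i ∈ Set.Icc a b := by
  simpa only [smul_eq_mul] using
    (convex_Icc a b).sum_mem (fun i _ => hp.1 i) hp.2 fun i _ => hf i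

theorem exists_sum_mul_le_of_mem_stdSimplex (hp : p ∈ stdSimplex ℝ ι) (f : ι → ℝ) :
    ∃ i, ∑ j, p j * f j ≤ f i := by
  by_contra! hlt
  refine lt_irrefl (∑ j, p j * f j) ?_
  simpa only [smul_eq_mul, Set.mem_Iio] using
    (convex_Iio (∑ j, p j * f j)).sum_mem (fun i _ => hp.1 i) hp.2 fun i _ => hlt i

theorem abs_sum_mul_sub_sum_mul_le (hp : ∀ i, 0 ≤ p i) (f g : ι → ℝ) :
    |∑ i, p i * f i - ∑ i, p i * g i| ≤ ∑ i, p i * |f i - g i| := by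
  rw [← Finset.sum_sub_distrib]
  refine (Finset.abs_sum_le_sum_abs _ _).trans_eq (Finset.sum_congr rfl fun i _ => ?_)
  rw [← mul_sub, abs_mul, abs_of_nonneg (hp i)]

theorem prod_mem_stdSimplex {κ α : Type*} [Fintype κ] [DecidableEq κ] [Fintype α]
    {q : κ → α → ℝ} (hq : ∀ k, q k ∈ stdSimplex ℝ α) :
    (fun f : κ → α => ∏ k, q k (f k)) ∈ stdSimplex ℝ (κ → α) := by
  refine ⟨fun f => Finset.prod_nonneg fun k _ => (hq k).1 _, ?_⟩
  rw [← Fintype.prod_sum]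
  exact Finset.prod_eq_one fun k _ => (hq k).2

theorem sum_prod_mul_ite_eq {κ α : Type*} [Fintype κ] [DecidableEq κ] [Fintype α]
    [DecidableEq α] {q : κ → α → ℝ} (hq : ∀ k, q k ∈ stdSimplex ℝ α) (k₀ : κ) (a₀ : α) :
    ∑ f : κ → α, (∏ k, q k (f k)) * (if f k₀ = a₀ then 1 else 0) = q k₀ a₀ := by
  have hfactor : ∀ f : κ → α, (∏ k, q k (f k)) * (if f k₀ = a₀ then 1 else 0) =
      ∏ k, q k (f k) * if k = k₀ then (if f k = a₀ then 1 else 0) else 1 := by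
    intro f
    rw [Finset.prod_mul_distrib, Finset.prod_ite_eq' Finset.univ k₀, if_pos (Finset.mem_univ _)]
  simp_rw [hfactor]
  rw [← Fintype.prod_sum fun k a => q k a * if k = k₀ then (if a = a₀ then 1 else 0) else 1,
    Fintype.prod_eq_single k₀ fun k hk => by simp [hk, (hq k).2]]
  simp

end Simplex

section OptimalDesign

theorem sum_nonpos_of_prod_one_add_mul_le_one {X : Type*} (s : Finset X) (c : X → ℝ)
    (hprod : ∀ t ∈ Set.Ioo (0 : ℝ) 1, ∏ x ∈ s, (1 + t * c x) ≤ 1) : ∑ x ∈ s, c x ≤ 0 := by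
  classical
  have hderiv : HasDerivAt (fun t : ℝ => ∏ x ∈ s, (1 + t * c x)) (∑ x ∈ s, c x) 0 := by
    have hfactor : ∀ x ∈ s, HasDerivAt (fun t : ℝ => 1 + t * c x) (c x) 0 := fun x _ => by
      simpa using ((hasDerivAt_id (0 : ℝ)).mul_const (c x)).const_add 1
    simpa using HasDerivAt.fun_finsetProd hfactor
  refine le_of_tendsto hderiv.tendsto_slope_zero_right
    (Filter.eventually_of_mem (Ioo_mem_nhdsGT one_pos) fun t ht => ?_)
  simpa using mul_nonpos_of_nonneg_of_nonpos (inv_nonneg.2 ht.1.le)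
    (sub_nonpos.2 (by simpa using hprod t ht))

variable {ρ X : Type*} [Fintype ρ]

theorem vecMul_nonneg {d : Matrix ρ X ℝ} (hd : ∀ i x, 0 ≤ d i x) {w : ρ → ℝ}
    (hw : ∀ i, 0 ≤ w i) (x : X) : 0 ≤ (w ᵥ* d) x :=
  Finset.sum_nonneg fun i _ => mul_nonneg (hw i) (hd i x)

theorem continuous_vecMul_apply (d : Matrix ρ X ℝ) (x : X) :
    Continuous fun w : ρ → ℝ => (w ᵥ* d) x := by
  unfold Matrix.vecMul dotProduct
  fun_prop

theorem vecMul_lineMap_apply (d : Matrix ρ X ℝ) (w v : ρ → ℝ) (t : ℝ) (x : X) :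
    (((1 - t) • w + t • v) ᵥ* d) x = (1 - t) * (w ᵥ* d) x + t * (v ᵥ* d) x := by
  simp [Matrix.add_vecMul, Matrix.smul_vecMul]

/-- The first-order condition at a maximizer of the product of the mixed columns. -/
theorem exists_sum_div_vecMul_le_card {d : Matrix ρ X ℝ} (hd : ∀ i x, 0 ≤ d i x)
    {s : Finset X} {u : ρ → ℝ} (hu : u ∈ stdSimplex ℝ ρ) (hpos : ∀ x ∈ s, 0 < (u ᵥ* d) x) :
    ∃ w ∈ stdSimplex ℝ ρ, (∀ x ∈ s, 0 < (w ᵥ* d) x) ∧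
      ∀ i, ∑ x ∈ s, d i x / (w ᵥ* d) x ≤ s.card := by
  classical
  obtain ⟨w, hw, hmax⟩ := (isCompact_stdSimplex ℝ ρ).exists_isMaxOn ⟨u, hu⟩
    (continuous_finsetProd s fun x _ => continuous_vecMul_apply d x).continuousOn
  have hwpos : ∀ x ∈ s, 0 < (w ᵥ* d) x := fun x hx =>
    (vecMul_nonneg hd hw.1 x).lt_of_ne fun h0 =>
      ((hmax hu).trans_eq (Finset.prod_eq_zero hx h0.symm)).not_gt (Finset.prod_pos hpos)
  refine ⟨w, hw, hwpos, fun i => ?_⟩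
  have hcond : ∑ x ∈ s, (d i x / (w ᵥ* d) x - 1) ≤ 0 := by
    refine sum_nonpos_of_prod_one_add_mul_le_one s _ fun t ht => ?_
    have hfactor : ∀ x ∈ s, (((1 - t) • w + t • Pi.single i 1) ᵥ* d) x =
        (w ᵥ* d) x * (1 + t * (d i x / (w ᵥ* d) x - 1)) := fun x hx => by
      have hne := (hwpos x hx).ne'
      rw [vecMul_lineMap_apply, Matrix.single_one_vecMul, Matrix.row_apply]
      field_simp
      ring
    refine le_of_mul_le_mul_left ?_ (Finset.prod_pos hwpos)
    rw [mul_one, ← Finset.prod_mul_distrib, ← Finset.prod_congr rfl hfactor]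
    exact hmax (convex_stdSimplex ℝ ρ hw (single_mem_stdSimplex ℝ i) (sub_nonneg.2 ht.2.le)
      ht.1.le (sub_add_cancel 1 t))
  simpa [Finset.sum_sub_distrib] using hcond

/-- Halfway between a feasible mixture and the maximizer of the product, both the constraint and
the first-order condition survive up to a factor `2`. -/
theorem exists_le_vecMul_sum_div_le_two_mul_card {d : Matrix ρ X ℝ} (hd : ∀ i x, 0 ≤ d i x)
    {s : Finset X} {θ : ℝ} (hθ : 0 < θ) {u : ρ → ℝ} (hu : u ∈ stdSimplex ℝ ρ)
    (hfeas : ∀ x ∈ s, 2 * θ ≤ (u ᵥ* d) x) :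
    ∃ w ∈ stdSimplex ℝ ρ, (∀ x ∈ s, θ ≤ (w ᵥ* d) x) ∧
      ∀ i, ∑ x ∈ s, d i x / (w ᵥ* d) x ≤ 2 * s.card := by
  have hupos : ∀ x ∈ s, 0 < (u ᵥ* d) x := fun x hx => by linarith [hfeas x hx]
  obtain ⟨v, hv, hvpos, hvsum⟩ := exists_sum_div_vecMul_le_card hd hu hupos
  have hhalf : ∀ x, (((1 - 1 / 2 : ℝ) • v + (1 / 2 : ℝ) • u) ᵥ* d) x =
      ((v ᵥ* d) x + (u ᵥ* d) x) / 2 := fun x => by rw [vecMul_lineMap_apply]; ring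
  refine ⟨(1 - 1 / 2 : ℝ) • v + (1 / 2 : ℝ) • u, convex_stdSimplex ℝ ρ hv hu (by norm_num)
    (by norm_num) (by norm_num), fun x hx => ?_, fun i => ?_⟩
  · rw [hhalf]
    linarith [hfeas x hx, hvpos x hx]
  · calc ∑ x ∈ s, d i x / (((1 - 1 / 2 : ℝ) • v + (1 / 2 : ℝ) • u) ᵥ* d) x
        ≤ ∑ x ∈ s, d i x / ((v ᵥ* d) x / 2) := Finset.sum_le_sum fun x hx => by
          rw [hhalf]
          have hvx := hvpos x hx
          have hux := hupos x hx
          have hdx := hd i x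
          gcongr
          linarith
      _ = 2 * ∑ x ∈ s, d i x / (v ᵥ* d) x := by
          rw [Finset.mul_sum]
          exact Finset.sum_congr rfl fun x _ => by ring
      _ ≤ 2 * s.card := by gcongr; exact hvsum i

theorem exists_isMinOn_iSup_sum_div_vecMul [Nonempty ρ] (d : Matrix ρ X ℝ) (s : Finset X)
    {θ : ℝ} (hθ : 0 < θ) {u : ρ → ℝ} (hu : u ∈ stdSimplex ℝ ρ)
    (hfeas : ∀ x ∈ s, θ ≤ (u ᵥ* d) x) :
    ∃ w ∈ {w ∈ stdSimplex ℝ ρ | ∀ x ∈ s, θ ≤ (w ᵥ* d) x},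
      IsMinOn (fun w => ⨆ i, ∑ x ∈ s, d i x / (w ᵥ* d) x)
        {w ∈ stdSimplex ℝ ρ | ∀ x ∈ s, θ ≤ (w ᵥ* d) x} w := by
  have hclosed : IsClosed {w : ρ → ℝ | ∀ x ∈ s, θ ≤ (w ᵥ* d) x} := by
    simp only [Set.ofPred_forall]
    exact isClosed_iInter fun x => isClosed_iInter fun _ =>
      isClosed_le continuous_const (continuous_vecMul_apply d x)
  refine ((isCompact_stdSimplex ℝ ρ).inter_right hclosed).exists_isMinOn ⟨u, hu, hfeas⟩ ?_
  simp only [← Finset.sup'_univ_eq_ciSup]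
  refine ContinuousOn.finset_sup'_apply _ fun i _ => continuousOn_finsetSum _ fun x hx => ?_
  exact continuousOn_const.div (continuous_vecMul_apply d x).continuousOn
    fun w hw => (hθ.trans_le (hw.2 x hx)).ne'

end OptimalDesign

section Model

variable {S A : Type*} [Fintype S] {H : ℕ}

/-- Conditional mean of the next state's value; like `nextValue`, it is `0` at the last layer. -/
def MDP.nextMean (M : MDP S A H) (h : Fin H) (x : S × A) (V : S → ℝ) : ℝ :=
  if h.val + 1 < H then ∑ s', M.P h x.1 x.2 s' * V s' else 0

theorem MDP.nextMean_mem_Icc (M : MDP S A H) (h : Fin H) (x : S × A) {V : S → ℝ} {B : ℝ}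
    (hV : ∀ s, V s ∈ Set.Icc 0 B) : M.nextMean h x V ∈ Set.Icc 0 B := by
  unfold MDP.nextMean
  split_ifs
  · exact sum_mul_mem_Icc_of_mem_stdSimplex (M.P_mem _ _ _) hV
  · exact Set.left_mem_Icc.2 ((hV M.s₁).1.trans (hV M.s₁).2)

theorem MDP.nextMean_mono (M : MDP S A H) (h : Fin H) (x : S × A) {U V : S → ℝ}
    (hUV : ∀ s, U s ≤ V s) : M.nextMean h x U ≤ M.nextMean h x V := by
  unfold MDP.nextMean
  split_ifs
  · exact Finset.sum_le_sum fun s _ => mul_le_mul_of_nonneg_left (hUV s) ((M.P_mem _ _ _).1 s)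
  · exact le_rfl

theorem MDP.nextMean_zero (M : MDP S A H) (h : Fin H) (x : S × A) : M.nextMean h x 0 = 0 := by
  simp [MDP.nextMean]

theorem MDP.nextMean_nonneg (M : MDP S A H) (h : Fin H) (x : S × A) {V : S → ℝ}
    (hV : ∀ s, 0 ≤ V s) : 0 ≤ M.nextMean h x V :=
  (M.nextMean_zero h x).symm.trans_le (M.nextMean_mono h x hV)

theorem MDP.abs_nextMean_sub_nextMean_le (M : MDP S A H) (h : Fin H) (x : S × A)
    (U V : S → ℝ) :
    |M.nextMean h x U - M.nextMean h x V| ≤ M.nextMean h x fun s => |U s - V s| := by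
  unfold MDP.nextMean
  split_ifs
  · exact abs_sum_mul_sub_sum_mul_le (M.P_mem _ _ _).1 U V
  · simp

/-- The MDP of the layers after the first one, started at `s`. -/
def MDP.tail (M : MDP S A (H + 1)) (s : S) : MDP S A H where
  P h := M.P h.succ
  P_mem h := M.P_mem h.succ
  s₁ := s

theorem MDP.nextMean_tail (M : MDP S A (H + 1)) (s : S) (h : Fin H) :
    (M.tail s).nextMean h = M.nextMean h.succ := by
  ext x V
  simp [MDP.nextMean, MDP.tail]

/-- The policy followed in the layers after the first one. -/
def Policy.tail [Fintype A] (π : Policy S A (H + 1)) : Policy S A H :=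
  ⟨fun h => π.1 h.succ, fun h => π.2 h.succ⟩

end Model

section Trajectories

variable {S A : Type*} [Fintype S] [DecidableEq S] {H : ℕ}

theorem MDP.stateProb_nonneg (M : MDP S A H) (τ : Traj S A H) (h : Fin H) :
    0 ≤ M.stateProb τ h := by
  unfold MDP.stateProb
  split_ifs
  · exact zero_le_one
  · exact le_rfl
  · exact (M.P_mem _ _ _).1 _

variable [Fintype A]

theorem MDP.trajProb_nonneg (M : MDP S A H) (π : Policy S A H) (τ : Traj S A H) :
    0 ≤ M.trajProb π τ :=
  Finset.prod_nonneg fun h _ => mul_nonneg (M.stateProb_nonneg τ h) ((π.2 h _).1 _)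

theorem MDP.trajProb_eq_zero (M : MDP S A (H + 1)) (π : Policy S A (H + 1))
    {τ : Traj S A (H + 1)} (hτ : (τ 0).1 ≠ M.s₁) : M.trajProb π τ = 0 :=
  Finset.prod_eq_zero (Finset.mem_univ 0) (by simp [MDP.stateProb, hτ])

theorem MDP.trajProb_cons (M : MDP S A (H + 1)) (π : Policy S A (H + 1)) (x : S × A)
    (τ : Traj S A H) :
    M.trajProb π (Fin.cons x τ) =
      (if x.1 = M.s₁ then 1 else 0) * π.1 0 x.1 x.2 *
        ∑ s', M.P 0 x.1 x.2 s' * (M.tail s').trajProb π.tail τ := by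
  unfold MDP.trajProb
  rw [Fin.prod_univ_succ]
  congr 1
  cases H with
  | zero => simp [(M.P_mem _ _ _).2]
  | succ n =>
    rw [Finset.sum_eq_single (τ 0).1]
    · rw [Fin.prod_univ_succ, Fin.prod_univ_succ, ← mul_assoc]
      congr 1
      simp [MDP.stateProb, MDP.tail, Policy.tail]
    · intro s' _ hs'
      rw [Fin.prod_univ_succ]
      simp [MDP.stateProb, MDP.tail, hs'.symm]
    · simp

/-- Expectation of a function of the trajectory. -/
def MDP.expect (M : MDP S A H) (π : Policy S A H) (F : Traj S A H → ℝ) : ℝ :=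
  ∑ τ, M.trajProb π τ * F τ

theorem MDP.expect_congr (M : MDP S A (H + 1)) (π : Policy S A (H + 1))
    {F G : Traj S A (H + 1) → ℝ} (h : ∀ τ, (τ 0).1 = M.s₁ → F τ = G τ) :
    M.expect π F = M.expect π G := by
  refine Finset.sum_congr rfl fun τ _ => ?_
  by_cases hτ : (τ 0).1 = M.s₁
  · rw [h τ hτ]
  · rw [M.trajProb_eq_zero π hτ, zero_mul, zero_mul]

theorem MDP.expect_const_mul (M : MDP S A H) (π : Policy S A H) (c : ℝ) (F : Traj S A H → ℝ) :
    M.expect π (fun τ => c * F τ) = c * M.expect π F := by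
  simp only [MDP.expect, Finset.mul_sum, mul_left_comm]

theorem MDP.expect_add (M : MDP S A H) (π : Policy S A H) (F G : Traj S A H → ℝ) :
    M.expect π (fun τ => F τ + G τ) = M.expect π F + M.expect π G := by
  simp only [MDP.expect, mul_add, Finset.sum_add_distrib]

theorem MDP.expect_zero (M : MDP S A 0) (π : Policy S A 0) (F : Traj S A 0 → ℝ) :
    M.expect π F = F default := by
  simp [MDP.expect, MDP.trajProb]

theorem MDP.expect_succ (M : MDP S A (H + 1)) (π : Policy S A (H + 1))
    (F : Traj S A (H + 1) → ℝ) :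
    M.expect π F = ∑ a, π.1 0 M.s₁ a * ∑ s', M.P 0 M.s₁ a s' *
      (M.tail s').expect π.tail (fun τ => F (Fin.cons (M.s₁, a) τ)) := by
  unfold MDP.expect
  have hcons : ∀ f : Traj S A (H + 1) → ℝ,
      ∑ τ, f τ = ∑ s, ∑ a, ∑ τ : Traj S A H, f (Fin.cons (s, a) τ) := by
    intro f
    rw [← (Fin.consEquiv fun _ : Fin (H + 1) => S × A).sum_comp f, Fintype.sum_prod_type,
      Fintype.sum_prod_type]
    rfl
  rw [hcons, Finset.sum_eq_single M.s₁]
  · refine Finset.sum_congr rfl fun a _ => ?_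
    simp only [MDP.trajProb_cons, if_true, one_mul, Finset.mul_sum, Finset.sum_mul]
    rw [Finset.sum_comm]
    refine Finset.sum_congr rfl fun s' _ => Finset.sum_congr rfl fun τ _ => ?_
    ring
  · intro s _ hs
    refine Finset.sum_eq_zero fun a _ => Finset.sum_eq_zero fun τ _ => ?_
    simp [MDP.trajProb_cons, hs]
  · simp

theorem MDP.expect_one (M : MDP S A H) (π : Policy S A H) : M.expect π (fun _ => 1) = 1 := by
  induction H with
  | zero => exact M.expect_zero π _
  | succ n ih =>
    rw [M.expect_succ]
    simp [ih, (M.P_mem _ _ _).2, (π.2 0 M.s₁).2]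

theorem MDP.trajProb_mem_stdSimplex (M : MDP S A H) (π : Policy S A H) :
    M.trajProb π ∈ stdSimplex ℝ (Traj S A H) :=
  ⟨M.trajProb_nonneg π, by simpa only [MDP.expect, mul_one] using M.expect_one π⟩

/-- Product along a trajectory of weights of its transitions. -/
def transProd (G : Fin H → S × A → S → ℝ) (τ : Traj S A H) : ℝ :=
  ∏ j : Fin H, if hj : j.val + 1 < H then G j (τ j) (τ ⟨j.val + 1, hj⟩).1 else 1

omit [Fintype S] [DecidableEq S] [Fintype A] in
theorem transProd_cons {G : Fin (H + 2) → S × A → S → ℝ} (x : S × A) (τ : Traj S A (H + 1)) :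
    transProd G (Fin.cons x τ) = G 0 x (τ 0).1 * transProd (fun j => G j.succ) τ := by
  unfold transProd
  rw [Fin.prod_univ_succ]
  congr 1
  refine Finset.prod_congr rfl fun j _ => ?_
  simp only [Fin.val_succ, add_lt_add_iff_right, Fin.cons_succ]
  rfl

/-- Transition weights of conditional mean at most `1` form a supermartingale along a
trajectory. -/
theorem MDP.expect_transProd_le_one (M : MDP S A H) (π : Policy S A H)
    {G : Fin H → S × A → S → ℝ} (hG : ∀ j x s, 0 ≤ G j x s)
    (hmean : ∀ j x, ∑ s', M.P j x.1 x.2 s' * G j x s' ≤ 1) :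
    M.expect π (transProd G) ≤ 1 := by
  induction H with
  | zero => simp [M.expect_zero, transProd]
  | succ n ih =>
    suffices hfirst : ∀ a, ∑ s', M.P 0 M.s₁ a s' *
        (M.tail s').expect π.tail (fun τ => transProd G (Fin.cons (M.s₁, a) τ)) ≤ 1 by
      rw [M.expect_succ, ← (π.2 0 M.s₁).2]
      exact Finset.sum_le_sum fun a _ => mul_le_of_le_one_right ((π.2 0 M.s₁).1 a) (hfirst a)
    intro a
    cases n with
    | zero => simp [MDP.expect_zero, transProd, (M.P_mem _ _ _).2]
    | succ n =>
      refine le_trans (Finset.sum_le_sum fun s' _ => ?_) (hmean 0 (M.s₁, a))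
      refine mul_le_mul_of_nonneg_left ?_ ((M.P_mem _ _ _).1 s')
      have hsplit : (M.tail s').expect π.tail (fun τ => transProd G (Fin.cons (M.s₁, a) τ)) =
          (M.tail s').expect π.tail
            (fun τ => G 0 (M.s₁, a) s' * transProd (fun j => G j.succ) τ) :=
        MDP.expect_congr _ _ fun τ hτ => by rw [transProd_cons, hτ]; rfl
      rw [hsplit, MDP.expect_const_mul]
      exact mul_le_of_le_one_right (hG _ _ _)
        (ih (M.tail s') π.tail (fun j => hG j.succ) fun j => hmean j.succ)

end Trajectories

section Values

variable {S A : Type*} [Fintype S] [DecidableEq S] [Fintype A] {H : ℕ}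

theorem MDP.value_succ (M : MDP S A (H + 1)) (π : Policy S A (H + 1)) (r : Reward S A (H + 1)) :
    M.value π r = ∑ a, π.1 0 M.s₁ a * (r 0 M.s₁ a + M.nextMean 0 (M.s₁, a)
      fun s' => (M.tail s').value π.tail fun h => r h.succ) := by
  have htail : ∀ a s', (M.tail s').expect π.tail (fun τ => ∑ h : Fin (H + 1),
      r h ((Fin.cons (M.s₁, a) τ : Traj S A (H + 1)) h).1
        ((Fin.cons (M.s₁, a) τ : Traj S A (H + 1)) h).2) =
      r 0 M.s₁ a + (M.tail s').value π.tail fun h => r h.succ := by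
    intro a s'
    change _ = _ + (M.tail s').expect π.tail fun τ => ∑ h : Fin H, r h.succ (τ h).1 (τ h).2
    rw [← mul_one (r 0 M.s₁ a), ← MDP.expect_one (M.tail s') π.tail,
      ← MDP.expect_const_mul, ← MDP.expect_add]
    simp [Fin.sum_univ_succ]
  refine (M.expect_succ π _).trans (Finset.sum_congr rfl fun a _ => ?_)
  simp only [htail, mul_add, Finset.sum_add_distrib, ← Finset.sum_mul, (M.P_mem _ _ _).2, one_mul]
  cases H with
  | zero => simp [MDP.nextMean, MDP.value]
  | succ n => simp [MDP.nextMean, Finset.mul_sum]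

variable [DecidableEq A]

theorem MDP.value_eq_sum_occ (M : MDP S A H) (π : Policy S A H) (r : Reward S A H) :
    M.value π r = ∑ h, ∑ x : S × A, M.occ π h x * r h x.1 x.2 := by
  simp only [MDP.value, MDP.occ, Finset.mul_sum, Finset.sum_mul]
  rw [Finset.sum_comm]
  refine Finset.sum_congr rfl fun h _ => ?_
  rw [Finset.sum_comm]
  refine Finset.sum_congr rfl fun τ _ => ?_
  simp [ite_mul]

theorem MDP.occ_mem_stdSimplex (M : MDP S A H) (π : Policy S A H) (h : Fin H) :
    M.occ π h ∈ stdSimplex ℝ (S × A) := by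
  refine ⟨fun x => Finset.sum_nonneg fun τ _ => ?_, ?_⟩
  · split_ifs
    exacts [M.trajProb_nonneg π τ, le_rfl]
  · simp only [MDP.occ]
    rw [Finset.sum_comm]
    simp [(M.trajProb_mem_stdSimplex π).2]

theorem MDP.occ_eq_zero (M : MDP S A H) (π : Policy S A H) {h : Fin H} {x : S × A}
    (hx : x ∉ layerPairs M.s₁ h) : M.occ π h x = 0 := by
  unfold layerPairs at hx
  split_ifs at hx with h0
  · refine Finset.sum_eq_zero fun τ _ => ?_
    split_ifs with hτ
    · obtain ⟨n, rfl⟩ := Nat.exists_eq_add_one.2 h.pos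
      obtain rfl : h = 0 := Fin.ext h0
      exact M.trajProb_eq_zero π fun h1 => hx (by simp [← h1, ← hτ])
    · rfl
  · exact absurd (Finset.mem_univ x) hx

/-- The reward `1` for the pair `x` at layer `h`, whose value is the occupancy of `x`. -/
def visitReward (h : Fin H) (x : S × A) : Reward S A H :=
  fun j s a => if j = h ∧ (s, a) = x then 1 else 0

theorem MDP.value_visitReward (M : MDP S A H) (π : Policy S A H) (h : Fin H) (x : S × A) :
    M.value π (visitReward h x) = M.occ π h x := by
  rw [M.value_eq_sum_occ, Finset.sum_eq_single h, Finset.sum_eq_single x]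
  all_goals simp +contextual [visitReward]

/-- Value from layer `j` on of a deterministic policy, by backward recursion. -/
def MDP.detVal (M : MDP S A H) (π : DetPolicy S A H) (r : Reward S A H) (j : ℕ) : S → ℝ :=
  if hj : j < H then fun s => r ⟨j, hj⟩ s (π ⟨j, hj⟩ s) +
      M.nextMean ⟨j, hj⟩ (s, π ⟨j, hj⟩ s) (M.detVal π r (j + 1))
  else 0
termination_by H - j

omit [DecidableEq S] [Fintype A] [DecidableEq A]

theorem MDP.detVal_of_lt (M : MDP S A H) (π : DetPolicy S A H) (r : Reward S A H) {j : ℕ}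
    (hj : j < H) (s : S) : M.detVal π r j s = r ⟨j, hj⟩ s (π ⟨j, hj⟩ s) +
      M.nextMean ⟨j, hj⟩ (s, π ⟨j, hj⟩ s) (M.detVal π r (j + 1)) := by
  rw [MDP.detVal, dif_pos hj]

theorem MDP.detVal_of_le (M : MDP S A H) (π : DetPolicy S A H) (r : Reward S A H) {j : ℕ}
    (hj : H ≤ j) : M.detVal π r j = 0 := by
  rw [MDP.detVal, dif_neg hj.not_gt]

theorem MDP.detVal_succ (M : MDP S A (H + 1)) (π : DetPolicy S A (H + 1))
    (r : Reward S A (H + 1)) (s₀ : S) (j : ℕ) :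
    M.detVal π r (j + 1) =
      (M.tail s₀).detVal (fun h => π h.succ) (fun h => r h.succ) j := by
  by_cases hj : j < H
  · have ih := M.detVal_succ π r s₀ (j + 1)
    funext s
    rw [MDP.detVal_of_lt _ _ _ hj, MDP.detVal_of_lt _ _ _ (Nat.succ_lt_succ hj), ih,
      MDP.nextMean_tail]
    rfl
  · rw [MDP.detVal_of_le _ _ _ (not_lt.1 hj), MDP.detVal_of_le _ _ _ (by omega)]
termination_by H - j

theorem MDP.detVal_mem_Icc (M : MDP S A H) (π : DetPolicy S A H) {r : Reward S A H}
    {c : Fin H → ℝ} (hr : ∀ h s a, r h s a ∈ Set.Icc 0 (c h)) (j : ℕ) (s : S) :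
    M.detVal π r j s ∈ Set.Icc 0 (∑ i with j ≤ i.val, c i) := by
  by_cases hj : j < H
  · have ih := M.nextMean_mem_Icc ⟨j, hj⟩ (s, π ⟨j, hj⟩ s) (M.detVal_mem_Icc π hr (j + 1))
    have hsum : ∑ i with j ≤ i.val, c i = c ⟨j, hj⟩ + ∑ i with j + 1 ≤ i.val, c i := by
      rw [← Finset.sum_insert (by simp)]
      congr 1
      ext i
      simp only [Finset.mem_filter, Finset.mem_univ, true_and, Finset.mem_insert, Fin.ext_iff]
      omega
    rw [M.detVal_of_lt π r hj, hsum]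
    have hr0 := hr ⟨j, hj⟩ s (π ⟨j, hj⟩ s)
    exact ⟨add_nonneg hr0.1 ih.1, add_le_add hr0.2 ih.2⟩
  · rw [M.detVal_of_le _ _ (not_lt.1 hj), Finset.filter_eq_empty_iff.2 fun i _ => by omega]
    simp
termination_by H - j

theorem MDP.detVal_mem_Icc_of_isValidReward (M : MDP S A H) (π : DetPolicy S A H)
    {r : Reward S A H} (hr : IsValidReward r) (j : ℕ) (s : S) :
    M.detVal π r j s ∈ Set.Icc 0 (H : ℝ) := by
  refine Set.Icc_subset_Icc_right ?_ (M.detVal_mem_Icc π (c := fun _ => 1) hr j s)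
  simpa using Finset.card_le_univ (α := Fin H) (Finset.univ.filter fun i => j ≤ i.val)

section VisitReward

variable [DecidableEq S] [DecidableEq A]

omit [Fintype S] in
theorem visitReward_mem_Icc (h : Fin H) (x : S × A) (j : Fin H) (s : S) (a : A) :
    visitReward h x j s a ∈ Set.Icc (0 : ℝ) (Pi.single (M := fun _ => ℝ) h 1 j) := by
  simp only [visitReward, Pi.single_apply]
  split_ifs <;> simp_all

theorem MDP.detVal_visitReward_mem_Icc (M : MDP S A H) (π : DetPolicy S A H) (h : Fin H)
    (x : S × A) (j : ℕ) (s : S) : M.detVal π (visitReward h x) j s ∈ Set.Icc (0 : ℝ) 1 := by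
  refine Set.Icc_subset_Icc_right ?_ (M.detVal_mem_Icc π (visitReward_mem_Icc h x) j s)
  rw [Finset.sum_pi_single']
  split_ifs
  exacts [le_rfl, zero_le_one]

theorem MDP.detVal_visitReward_of_lt (M : MDP S A H) (π : DetPolicy S A H) {h : Fin H}
    (x : S × A) {j : ℕ} (hj : h.val < j) : M.detVal π (visitReward h x) j = 0 := by
  funext s
  have hmem := M.detVal_mem_Icc π (visitReward_mem_Icc h x) j s
  rw [Finset.sum_pi_single', if_neg (by simpa using hj), Set.Icc_self] at hmem
  exact hmem

end VisitReward

variable [DecidableEq S] [Fintype A] [DecidableEq A]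

theorem MDP.value_toPolicy (M : MDP S A H) (π : DetPolicy S A H) (r : Reward S A H) :
    M.value (DetPolicy.toPolicy π) r = M.detVal π r 0 M.s₁ := by
  induction H with
  | zero => simp [MDP.value, MDP.detVal]
  | succ n ih =>
    rw [M.value_succ, M.detVal_of_lt _ _ (Nat.succ_pos n), Finset.sum_eq_single (π 0 M.s₁)]
    · have htail : Policy.tail (DetPolicy.toPolicy π) = DetPolicy.toPolicy fun h => π h.succ := rfl
      simp only [htail, ih]
      simp only [DetPolicy.toPolicy, Pi.single_eq_same, one_mul]
      congr 2
      funext s'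
      exact (congrFun (M.detVal_succ π r s' 0) s').symm
    · intro a _ ha
      simp [DetPolicy.toPolicy, ha]
    · simp

theorem MDP.abs_sub_value_le (M : MDP S A H) (π : DetPolicy S A H) (r b : Reward S A H)
    {U : ℕ → S → ℝ} (hU : U H = 0)
    (hstep : ∀ (j : Fin H) (s : S), |U j s - M.detVal π r j s| ≤ b j s (π j s) +
      M.nextMean j (s, π j s) fun s' => |U (j + 1) s' - M.detVal π r (j + 1) s'|) :
    |U 0 M.s₁ - M.value (DetPolicy.toPolicy π) r| ≤ M.value (DetPolicy.toPolicy π) b := by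
  have hlayer : ∀ j ≤ H, ∀ s, |U j s - M.detVal π r j s| ≤ M.detVal π b j s := by
    intro j hj
    induction hj using Nat.decreasingInduction with
    | self => simp [M.detVal_of_le, hU]
    | of_succ j hj ih =>
      intro s
      rw [M.detVal_of_lt π b hj]
      exact (hstep ⟨j, hj⟩ s).trans (add_le_add_right (M.nextMean_mono _ _ ih) _)
  rw [M.value_toPolicy, M.value_toPolicy]
  exact hlayer 0 (Nat.zero_le H) M.s₁

end Values

section Mixtures

variable {S A : Type*} [Fintype S] [DecidableEq S] [Fintype A] [DecidableEq A] {H : ℕ}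

theorem MDP.exists_mixTrajProb_eq_trajProb (M : MDP S A H) (π : Policy S A H) :
    ∃ w : Mixture S A H, M.mixTrajProb w = M.trajProb π := by
  refine ⟨⟨fun ρ => ∏ h, ∏ s, π.1 h s (ρ h s),
    prod_mem_stdSimplex fun h => prod_mem_stdSimplex (π.2 h)⟩, funext fun τ => ?_⟩
  calc ∑ ρ : DetPolicy S A H, (∏ h, ∏ s, π.1 h s (ρ h s)) * M.trajProb (DetPolicy.toPolicy ρ) τ
      = ∑ ρ : DetPolicy S A H, ∏ h, M.stateProb τ h *
          ((∏ s, π.1 h s (ρ h s)) * if ρ h (τ h).1 = (τ h).2 then 1 else 0) := by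
        refine Finset.sum_congr rfl fun ρ _ => ?_
        rw [MDP.trajProb, ← Finset.prod_mul_distrib]
        refine Finset.prod_congr rfl fun h _ => ?_
        simp only [DetPolicy.toPolicy, Pi.single_apply, eq_comm, mul_left_comm]
    _ = ∏ h, ∑ f : S → A, M.stateProb τ h *
          ((∏ s, π.1 h s (f s)) * if f (τ h).1 = (τ h).2 then 1 else 0) :=
        (Fintype.prod_sum fun h (f : S → A) => M.stateProb τ h *
          ((∏ s, π.1 h s (f s)) * if f (τ h).1 = (τ h).2 then 1 else 0)).symm
    _ = M.trajProb π τ := by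
        simp only [← Finset.mul_sum, sum_prod_mul_ite_eq (π.2 _), MDP.trajProb]

theorem MDP.sum_mixTrajProb_mul (M : MDP S A H) (w : Mixture S A H) (F : Traj S A H → ℝ) :
    ∑ τ, M.mixTrajProb w τ * F τ = ∑ π, w.1 π * M.expect (DetPolicy.toPolicy π) F := by
  simp only [MDP.mixTrajProb, MDP.expect, Finset.mul_sum, Finset.sum_mul, mul_assoc]
  exact Finset.sum_comm

theorem MDP.mixTrajProb_mem_stdSimplex (M : MDP S A H) (w : Mixture S A H) :
    M.mixTrajProb w ∈ stdSimplex ℝ (Traj S A H) := by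
  refine ⟨fun τ => Finset.sum_nonneg fun π _ => mul_nonneg (w.2.1 π) (M.trajProb_nonneg _ _), ?_⟩
  simpa [MDP.expect_one, w.2.2] using M.sum_mixTrajProb_mul w fun _ => 1

theorem MDP.exists_value_le_value_toPolicy (M : MDP S A H) (π : Policy S A H)
    (r : Reward S A H) :
    ∃ ρ : DetPolicy S A H, M.value π r ≤ M.value (DetPolicy.toPolicy ρ) r := by
  obtain ⟨w, hw⟩ := M.exists_mixTrajProb_eq_trajProb π
  have hvalue : M.value π r = ∑ ρ, w.1 ρ * M.value (DetPolicy.toPolicy ρ) r := by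
    rw [MDP.value, ← hw]
    exact M.sum_mixTrajProb_mul w _
  rw [hvalue]
  exact exists_sum_mul_le_of_mem_stdSimplex w.2 _

/-- Occupancy measure of a mixture. -/
def MDP.mixOcc (M : MDP S A H) (w : Mixture S A H) (h : Fin H) (x : S × A) : ℝ :=
  ∑ π : DetPolicy S A H, w.1 π * M.occ (DetPolicy.toPolicy π) h x

theorem MDP.mixOcc_eq_sum_mixTrajProb (M : MDP S A H) (w : Mixture S A H) (h : Fin H)
    (x : S × A) : M.mixOcc w h x = ∑ τ, M.mixTrajProb w τ * if τ h = x then 1 else 0 := by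
  rw [M.sum_mixTrajProb_mul]
  simp only [MDP.mixOcc, MDP.occ, MDP.expect, mul_ite, mul_one, mul_zero]

theorem MDP.mixOcc_mem_Icc (M : MDP S A H) (w : Mixture S A H) (h : Fin H) (x : S × A) :
    M.mixOcc w h x ∈ Set.Icc (0 : ℝ) 1 :=
  sum_mul_mem_Icc_of_mem_stdSimplex w.2 fun _ =>
    mem_Icc_of_mem_stdSimplex (M.occ_mem_stdSimplex _ h) x

theorem MDP.exists_mixOcc_eq_occ (M : MDP S A H) (π : Policy S A H) (h : Fin H) :
    ∃ w : Mixture S A H, M.mixOcc w h = M.occ π h := by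
  obtain ⟨w, hw⟩ := M.exists_mixTrajProb_eq_trajProb π
  refine ⟨w, funext fun x => ?_⟩
  rw [M.mixOcc_eq_sum_mixTrajProb, hw]
  simp only [MDP.occ, mul_ite, mul_one, mul_zero]

end Mixtures

section Clipping

theorem clip_mem_Icc {B : ℝ} (hB : 0 ≤ B) (x : ℝ) : clip B x ∈ Set.Icc 0 B :=
  ⟨le_max_left _ _, max_le hB (min_le_right _ _)⟩

theorem clip_of_mem_Icc {B x : ℝ} (hx : x ∈ Set.Icc 0 B) : clip B x = x := by
  rw [clip, min_eq_left hx.2, max_eq_right hx.1]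

theorem abs_clip_sub_clip_le (B x y : ℝ) : |clip B x - clip B y| ≤ |x - y| :=
  calc |clip B x - clip B y| ≤ max |(0 : ℝ) - 0| |min x B - min y B| :=
        abs_max_sub_max_le_max _ _ _ _
    _ = |min x B - min y B| := by simp
    _ ≤ max |x - y| |B - B| := abs_min_sub_min_le_max _ _ _ _
    _ = |x - y| := by simp

theorem abs_clip_sub_le {B x y : ℝ} (hy : y ∈ Set.Icc 0 B) : |clip B x - y| ≤ |x - y| := by
  simpa only [clip_of_mem_Icc hy] using abs_clip_sub_clip_le B x y

end Clipping

section Regression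

variable {S A : Type*} [DecidableEq S] [DecidableEq A] {H : ℕ} {I : Type*} [Fintype I]

/-- Number of visits of the pair `x` at layer `h`. -/
def visits (D : I → Traj S A H) (h : Fin H) (x : S × A) : ℝ :=
  ∑ n, if D n h = x then 1 else 0

theorem visits_nonneg (D : I → Traj S A H) (h : Fin H) (x : S × A) : 0 ≤ visits D h x :=
  Finset.sum_nonneg fun n _ => by split_ifs <;> norm_num

variable [Fintype S]

section Weights

variable [Fintype A]

omit [Fintype S] [Fintype A] in
theorem covMatrix_eq_diagonal (D : I → Traj S A H) (h : Fin H) :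
    covMatrix D h = Matrix.diagonal fun x => 1 + visits D h x := by
  ext x y
  have hentry : ∀ n, Matrix.vecMulVec (feature (D n h)) (feature (D n h)) x y =
      if x = y then (if D n h = x then (1 : ℝ) else 0) else 0 := by
    intro n
    simp only [Matrix.vecMulVec_apply, feature, Pi.single_apply]
    grind
  simp only [covMatrix, Matrix.add_apply, Matrix.sum_apply, hentry, Matrix.diagonal_apply,
    Matrix.one_apply, visits]
  split_ifs <;> simp

theorem lsviWeight_apply (D : I → Traj S A H) (h : Fin H) (V : S → ℝ) (x : S × A) :
    lsviWeight D h V x =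
      (∑ n, if D n h = x then nextValue (D n) h V else 0) / (1 + visits D h x) := by
  have hinv : (covMatrix D h)⁻¹ = Matrix.diagonal fun x => (1 + visits D h x)⁻¹ := by
    refine Matrix.inv_eq_right_inv ?_
    rw [covMatrix_eq_diagonal, Matrix.diagonal_mul_diagonal, ← Matrix.diagonal_one]
    congr 1
    funext y
    exact mul_inv_cancel₀ (by linarith [visits_nonneg D h y])
  rw [lsviWeight, hinv, Matrix.mulVec_diagonal, div_eq_inv_mul, Finset.sum_apply]
  simp [feature, Pi.single_apply, eq_comm]

theorem feature_dotProduct (x : S × A) (w : S × A → ℝ) : feature x ⬝ᵥ w = w x := by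
  simp [feature]

end Weights

omit [Fintype S] [DecidableEq S] in
theorem exists_apply_le_mul_apply_indicator [Finite S] (f : (S → ℝ) →ₗ[ℝ] ℝ) {V : S → ℝ} {B : ℝ}
    (hV : ∀ s, V s ∈ Set.Icc 0 B) :
    ∃ T : Finset S, f V ≤ B * f ((T : Set S).indicator 1) := by
  classical
  have := Fintype.ofFinite S
  refine ⟨Finset.univ.filter fun s => 0 ≤ f (Pi.single s 1), ?_⟩
  have hf : ∀ U, f U = ∑ s, U s * f (Pi.single s 1) := fun U =>
    (congrArg f (pi_eq_sum_univ' U)).trans (by simp)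
  rw [hf, hf, Finset.mul_sum]
  refine Finset.sum_le_sum fun s _ => ?_
  by_cases hs : 0 ≤ f (Pi.single s 1)
  · simpa [hs] using mul_le_mul_of_nonneg_right (hV s).2 hs
  · simpa [hs] using mul_nonpos_of_nonneg_of_nonpos (hV s).1 (not_le.1 hs).le

/-- Sum over the visits of `x` of the deviations of `nextValue` from its conditional mean, as a
linear functional of the value function. -/
def MDP.deviation (M : MDP S A H) (D : I → Traj S A H) (h : Fin H) (x : S × A) :
    (S → ℝ) →ₗ[ℝ] ℝ where
  toFun V := ∑ n, if D n h = x then nextValue (D n) h V - M.nextMean h x V else 0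
  map_add' U V := by
    rw [← Finset.sum_add_distrib]
    refine Finset.sum_congr rfl fun n _ => ?_
    unfold nextValue MDP.nextMean
    split_ifs <;> simp [mul_add, Finset.sum_add_distrib, add_sub_add_comm]
  map_smul' c V := by
    rw [smul_eq_mul, Finset.mul_sum]
    refine Finset.sum_congr rfl fun n _ => ?_
    unfold nextValue MDP.nextMean
    split_ifs <;> simp [Finset.mul_sum, mul_sub, mul_left_comm]

theorem MDP.deviation_apply (M : MDP S A H) (D : I → Traj S A H) (h : Fin H) (x : S × A)
    (V : S → ℝ) : M.deviation D h x V =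
      ∑ n, if D n h = x then nextValue (D n) h V - M.nextMean h x V else 0 :=
  rfl

theorem MDP.deviation_one (M : MDP S A H) (D : I → Traj S A H) (h : Fin H) (x : S × A) :
    M.deviation D h x 1 = 0 := by
  refine Finset.sum_eq_zero fun n _ => ?_
  unfold nextValue MDP.nextMean
  split_ifs <;> simp [(M.P_mem _ _ _).2]

/-- Largest deviation among indicator functions of sets of next states. -/
def MDP.maxDev (M : MDP S A H) (D : I → Traj S A H) (h : Fin H) (x : S × A) : ℝ :=
  ⨆ T : Finset S, M.deviation D h x ((T : Set S).indicator 1)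

theorem MDP.exists_maxDev_eq (M : MDP S A H) (D : I → Traj S A H) (h : Fin H) (x : S × A) :
    ∃ T : Finset S, M.deviation D h x ((T : Set S).indicator 1) = M.maxDev D h x :=
  exists_eq_ciSup_of_finite

theorem MDP.deviation_le (M : MDP S A H) (D : I → Traj S A H) (h : Fin H) (x : S × A)
    {V : S → ℝ} {B : ℝ} (hV : ∀ s, V s ∈ Set.Icc 0 B) :
    M.deviation D h x V ≤ B * M.maxDev D h x := by
  obtain ⟨T, hT⟩ := exists_apply_le_mul_apply_indicator (M.deviation D h x) hV
  have hB : 0 ≤ B := (hV M.s₁).1.trans (hV M.s₁).2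
  have hmax : M.deviation D h x ((T : Set S).indicator 1) ≤ M.maxDev D h x :=
    le_ciSup (Finite.bddAbove_range fun T : Finset S => M.deviation D h x
      ((T : Set S).indicator 1)) T
  exact hT.trans (mul_le_mul_of_nonneg_left hmax hB)

theorem MDP.abs_deviation_le (M : MDP S A H) (D : I → Traj S A H) (h : Fin H) (x : S × A)
    {V : S → ℝ} {B : ℝ} (hV : ∀ s, V s ∈ Set.Icc 0 B) :
    |M.deviation D h x V| ≤ B * M.maxDev D h x := by
  have hneg : M.deviation D h x (B • 1 - V) = -M.deviation D h x V := by
    rw [map_sub, map_smul, M.deviation_one, smul_zero, zero_sub]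
  have hcompl : M.deviation D h x (B • 1 - V) ≤ B * M.maxDev D h x :=
    M.deviation_le D h x fun s => ⟨by simp [(hV s).2], by simp [(hV s).1]⟩
  exact abs_le'.2 ⟨M.deviation_le D h x hV, hneg ▸ hcompl⟩

/-- Bound on the error of the regression at `x`, for value functions with values in `[0,1]`. -/
def MDP.localErr (M : MDP S A H) (D : I → Traj S A H) (h : Fin H) (x : S × A) : ℝ :=
  (M.maxDev D h x + 1) / (1 + visits D h x)

variable [Fintype A]

theorem MDP.abs_lsviWeight_sub_nextMean_le (M : MDP S A H) (D : I → Traj S A H) (h : Fin H)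
    (x : S × A) {V : S → ℝ} {B : ℝ} (hV : ∀ s, V s ∈ Set.Icc 0 B) :
    |lsviWeight D h V x - M.nextMean h x V| ≤ B * M.localErr D h x := by
  have hpos : 0 < 1 + visits D h x := by linarith [visits_nonneg D h x]
  have hdev : M.deviation D h x V = (∑ n, if D n h = x then nextValue (D n) h V else 0) -
      visits D h x * M.nextMean h x V := by
    rw [M.deviation_apply, visits, Finset.sum_mul, ← Finset.sum_sub_distrib]
    refine Finset.sum_congr rfl fun n _ => ?_
    split_ifs <;> simp
  have herr : lsviWeight D h V x - M.nextMean h x V =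
      (M.deviation D h x V - M.nextMean h x V) / (1 + visits D h x) := by
    rw [lsviWeight_apply, hdev]
    field_simp
    ring
  obtain ⟨hmean0, hmeanB⟩ := M.nextMean_mem_Icc h x hV
  rw [herr, abs_div, abs_of_pos hpos, MDP.localErr, mul_div_assoc', mul_add, mul_one]
  refine div_le_div_of_nonneg_right ((abs_sub _ _).trans ?_) hpos.le
  exact add_le_add (M.abs_deviation_le D h x hV) (by rwa [abs_of_nonneg hmean0])

theorem MDP.abs_clip_lsviWeight_add_sub_le (M : MDP S A H) (D : I → Traj S A H) (h : Fin H)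
    (x : S × A) {U V : S → ℝ} {B ρ : ℝ} (hU : ∀ s, U s ∈ Set.Icc 0 B)
    (hV : ρ + M.nextMean h x V ∈ Set.Icc 0 B) :
    |clip B (lsviWeight D h U x + ρ) - (ρ + M.nextMean h x V)| ≤
      B * M.localErr D h x + M.nextMean h x fun s => |U s - V s| :=
  calc |clip B (lsviWeight D h U x + ρ) - (ρ + M.nextMean h x V)|
      ≤ |lsviWeight D h U x + ρ - (ρ + M.nextMean h x V)| := abs_clip_sub_le hV
    _ = |(lsviWeight D h U x - M.nextMean h x U) + (M.nextMean h x U - M.nextMean h x V)| := by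
        congr 1
        ring
    _ ≤ _ := (abs_add_le _ _).trans (add_le_add (M.abs_lsviWeight_sub_nextMean_le D h x hU)
        (M.abs_nextMean_sub_nextMean_le h x U V))

end Regression

section Estimators

variable {S A : Type*} [Fintype S] [DecidableEq S] [Fintype A] [DecidableEq A] {H : ℕ}
variable {I : Type*} [Fintype I]

theorem evV_of_lt (D : I → Traj S A H) (π : DetPolicy S A H) (r : Reward S A H) {j : ℕ}
    (hj : j < H) (s : S) : evV D π r j s =
      clip H (lsviWeight D ⟨j, hj⟩ (evV D π r (j + 1)) (s, π ⟨j, hj⟩ s) +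
        r ⟨j, hj⟩ s (π ⟨j, hj⟩ s)) := by
  rw [evV, dif_pos hj]
  simp only [feature_dotProduct]

theorem evV_of_le (D : I → Traj S A H) (π : DetPolicy S A H) (r : Reward S A H) {j : ℕ}
    (hj : H ≤ j) : evV D π r j = 0 := by
  rw [evV, dif_neg (not_lt.2 hj)]

theorem evV_mem_Icc (D : I → Traj S A H) (π : DetPolicy S A H) (r : Reward S A H) (j : ℕ)
    (s : S) : evV D π r j s ∈ Set.Icc 0 (H : ℝ) := by
  rcases lt_or_ge j H with hj | hj
  · rw [evV_of_lt _ _ _ hj]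
    exact clip_mem_Icc (Nat.cast_nonneg _) _
  · rw [evV_of_le _ _ _ hj]
    simp

theorem MDP.abs_estimateV_sub_value_le (M : MDP S A H) (D : I → Traj S A H)
    (π : DetPolicy S A H) {r : Reward S A H} (hr : IsValidReward r) :
    |estimateV D M.s₁ π r - M.value (DetPolicy.toPolicy π) r| ≤
      M.value (DetPolicy.toPolicy π) fun j s a => H * M.localErr D j (s, a) := by
  refine M.abs_sub_value_le π r _ (U := evV D π r) (evV_of_le _ _ _ le_rfl) fun j s => ?_
  have hval := M.detVal_mem_Icc_of_isValidReward π hr j s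
  rw [M.detVal_of_lt π r j.isLt] at hval ⊢
  rw [evV_of_lt _ _ _ j.isLt]
  exact M.abs_clip_lsviWeight_add_sub_le D j _ (evV_mem_Icc D π r (j + 1)) hval

theorem erV_of_lt (D : I → Traj S A H) (π : DetPolicy S A H) (r : S → A → ℝ) (B : ℝ) (h : Fin H)
    {j : ℕ} (hj : j < h.val) (s : S) : erV D π r B h j s =
      clip B (lsviWeight D ⟨j, hj.trans h.isLt⟩ (erV D π r B h (j + 1))
        (s, π ⟨j, hj.trans h.isLt⟩ s)) := by
  rw [erV, dif_pos hj]
  simp only [feature_dotProduct]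

theorem erV_of_le (D : I → Traj S A H) (π : DetPolicy S A H) (r : S → A → ℝ) (B : ℝ) (h : Fin H)
    {j : ℕ} (hj : h.val ≤ j) (s : S) : erV D π r B h j s = r s (π h s) := by
  rw [erV, dif_neg hj.not_gt]

theorem erV_mem_Icc (D : I → Traj S A H) (π : DetPolicy S A H) {r : S → A → ℝ} {B : ℝ}
    (hr : ∀ s a, r s a ∈ Set.Icc 0 B) (h : Fin H) (j : ℕ) (s : S) :
    erV D π r B h j s ∈ Set.Icc 0 B := by
  rcases lt_or_ge j h.val with hj | hj
  · rw [erV_of_lt _ _ _ _ _ hj]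
    exact clip_mem_Icc ((hr s (π h s)).1.trans (hr s (π h s)).2) _
  · rw [erV_of_le _ _ _ _ _ hj]
    exact hr _ _

omit [Fintype S] [Fintype A] in
theorem indicator_eq_mem_Icc (x : S × A) (s : S) (a : A) :
    (if (s, a) = x then 1 else 0) ∈ Set.Icc (0 : ℝ) 1 := by
  split_ifs <;> simp

theorem estOcc_mem_Icc (D : I → Traj S A H) (s₁ : S) (h : Fin H) (π : DetPolicy S A H)
    (x : S × A) : estOcc D s₁ h π x ∈ Set.Icc (0 : ℝ) 1 :=
  erV_mem_Icc D π (indicator_eq_mem_Icc x) h 0 s₁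

theorem MDP.abs_estOcc_sub_occ_le (M : MDP S A H) (D : I → Traj S A H) (h : Fin H)
    (π : DetPolicy S A H) (x : S × A) :
    |estOcc D M.s₁ h π x - M.occ (DetPolicy.toPolicy π) h x| ≤
      M.value (DetPolicy.toPolicy π) fun j s a => if j < h then M.localErr D j (s, a) else 0 := by
  set E : ℕ → S → ℝ := erV D π (fun s a => if (s, a) = x then 1 else 0) 1 h with hE
  set U : ℕ → S → ℝ := fun j => if j ≤ h.val then E j else 0 with hU
  have hU0 : U 0 M.s₁ = estOcc D M.s₁ h π x := by simp [hU, hE, estOcc, estimateER]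
  have hUH : U H = 0 := if_neg h.isLt.not_ge
  rw [← M.value_visitReward, ← hU0]
  refine M.abs_sub_value_le π _ _ hUH fun j s => ?_
  rcases lt_or_ge j h with hj | hj
  · have hval := M.detVal_visitReward_mem_Icc π h x j s
    have hr : visitReward h x j s (π j s) = 0 := by simp [visitReward, hj.ne]
    have hj' : j.val < h.val := hj
    have hstep : U j s = clip 1 (lsviWeight D j (U (j + 1)) (s, π j s) + 0) := by
      simp only [hU, hE, hj'.le, Nat.succ_le_of_lt hj', if_true, erV_of_lt D π _ 1 h hj', add_zero]
    have hmem : ∀ s', U (j + 1) s' ∈ Set.Icc (0 : ℝ) 1 := fun s' => by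
      simpa only [hU, Nat.succ_le_of_lt hj', if_true] using
        erV_mem_Icc D π (indicator_eq_mem_Icc x) h (j + 1) s'
    rw [M.detVal_of_lt π _ j.isLt, hr] at hval ⊢
    rw [hstep, if_pos hj, ← one_mul (M.localErr D j _)]
    exact M.abs_clip_lsviWeight_add_sub_le D j _ hmem hval
  · have heq : U j s = M.detVal π (visitReward h x) j s := by
      rcases hj.eq_or_lt with rfl | hlt
      · simp [hU, hE, erV_of_le, M.detVal_of_lt π _ h.isLt, visitReward, MDP.nextMean_zero,
          M.detVal_visitReward_of_lt π x (Nat.lt_succ_self h.val)]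
      · have hlt' : h.val < j.val := hlt
        rw [M.detVal_visitReward_of_lt π x hlt', show U j = 0 from if_neg hlt'.not_ge]
    rw [heq, sub_self, abs_zero, if_neg hj.not_gt, zero_add]
    exact M.nextMean_nonneg _ _ fun _ => abs_nonneg _

end Estimators

section Design

variable {S A : Type*} [Fintype S] [DecidableEq S] [Fintype A] [DecidableEq A] {H : ℕ}
variable {I : Type*} [Fintype I]

theorem exists_isDesignSolution [Nonempty A] (D : I → Traj S A H) (s₁ : S) {θ : ℝ} (hθ : 0 < θ)
    (h : Fin H) {u : Mixture S A H} (hu : IsFeasible D s₁ θ h u) :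
    ∃ w, IsDesignSolution D s₁ θ h w := by
  have : Nonempty S := ⟨s₁⟩
  obtain ⟨w, ⟨hw, hfeas⟩, hmin⟩ :=
    exists_isMinOn_iSup_sum_div_vecMul (estOcc D s₁ h) (layerPairs s₁ h) hθ u.2 hu
  exact ⟨⟨w, hw⟩, hfeas, fun w' hw' => hmin ⟨w'.2, hw'⟩⟩

theorem IsDesignSolution.sum_div_le {D : I → Traj S A H} {s₁ : S} {θ : ℝ}
    (hθ : 0 < θ) {h : Fin H} {w : Mixture S A H} (hw : IsDesignSolution D s₁ θ h w)
    {u : Mixture S A H} (hu : IsFeasible D s₁ (2 * θ) h u) (π : DetPolicy S A H) :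
    ∑ x ∈ layerPairs s₁ h, estOcc D s₁ h π x / estOccMix D s₁ h w x ≤
      2 * (layerPairs (A := A) s₁ h).card := by
  have : Nonempty (DetPolicy S A H) := ⟨π⟩
  obtain ⟨v, hv, hfeas, hsum⟩ := exists_le_vecMul_sum_div_le_two_mul_card
    (d := estOcc D s₁ h) (fun π x => (estOcc_mem_Icc D s₁ h π x).1) hθ u.2 hu
  exact (le_ciSup (Finite.bddAbove_range fun π : DetPolicy S A H =>
    ∑ x ∈ layerPairs s₁ h, estOcc D s₁ h π x / estOccMix D s₁ h w x) π).trans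
    ((hw.2 ⟨v, hv⟩ hfeas).trans (ciSup_le hsum))

end Design

section AdaptiveSequences

variable {Y : Type*} [Fintype Y] {m : ℕ}

theorem sum_prod_take_succ (q : (k : Fin (m + 1)) → (Fin k → Y) → Y → ℝ) :
    ∑ D : Fin (m + 1) → Y, ∏ k, q k (Fin.take k k.isLt.le D) (D k) =
      ∑ D : Fin m → Y, (∏ k : Fin m, q k.castSucc (Fin.take k k.isLt.le D) (D k)) *
        ∑ y, q (Fin.last m) D y := by
  rw [← (Fin.snocEquiv fun _ => Y).sum_comp, Fintype.sum_prod_type_right]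
  refine Finset.sum_congr rfl fun D _ => ?_
  rw [Finset.mul_sum]
  refine Finset.sum_congr rfl fun y _ => ?_
  have htake : ∀ k (hk : k ≤ m),
      Fin.take k (Nat.le_succ_of_le hk) (Fin.snoc D y : Fin (m + 1) → Y) = Fin.take k hk D := by
    intro k hk
    rw [← Fin.take_init, Fin.init_snoc]
  change ∏ k : Fin (m + 1), q k (Fin.take k k.isLt.le (Fin.snoc D y : Fin (m + 1) → Y))
    ((Fin.snoc D y : Fin (m + 1) → Y) k) = _
  rw [Fin.prod_univ_castSucc, Fin.snoc_last]
  congr 1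
  · refine Finset.prod_congr rfl fun k _ => ?_
    rw [Fin.snoc_castSucc]
    exact congrArg (q k.castSucc · (D k)) (htake k k.isLt.le)
  · exact congrArg (q (Fin.last m) · y) ((htake m le_rfl).trans (Fin.take_eq_self D))

theorem sum_prod_take_eq_one (q : (k : Fin m) → (Fin k → Y) → Y → ℝ)
    (hsum : ∀ k D, ∑ y, q k D y = 1) :
    ∑ D : Fin m → Y, ∏ k, q k (Fin.take k k.isLt.le D) (D k) = 1 := by
  induction m with
  | zero => simp
  | succ m ih =>
    simp only [sum_prod_take_succ, hsum, mul_one]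
    exact ih (fun k => q k.castSucc) fun k => hsum k.castSucc

theorem sum_prod_take_le_one (q : (k : Fin m) → (Fin k → Y) → Y → ℝ)
    (hq : ∀ k D y, 0 ≤ q k D y) (hsum : ∀ k D, ∑ y, q k D y ≤ 1) :
    ∑ D : Fin m → Y, ∏ k, q k (Fin.take k k.isLt.le D) (D k) ≤ 1 := by
  induction m with
  | zero => simp
  | succ m ih =>
    rw [sum_prod_take_succ]
    refine le_trans (Finset.sum_le_sum fun D _ => ?_)
      (ih (fun k => q k.castSucc) (fun k => hq k.castSucc) fun k => hsum k.castSucc)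
    exact mul_le_of_le_one_right (Finset.prod_nonneg fun k _ => hq _ _ _)
      (hsum (Fin.last m) D)

end AdaptiveSequences

section DataLaw

variable {S A : Type*} [Fintype S] [DecidableEq S] [Fintype A] [DecidableEq A] {H m N : ℕ}
variable (alg : Scheme S A H m N) (M : MDP S A H)

theorem Scheme.dataProb_mem_stdSimplex :
    alg.dataProb M ∈ stdSimplex ℝ (Fin m → Fin N → Traj S A H) := by
  refine ⟨fun D => Finset.prod_nonneg fun k _ => Finset.prod_nonneg fun n _ =>
    (M.mixTrajProb_mem_stdSimplex _).1 _, ?_⟩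
  refine sum_prod_take_eq_one
    (fun k D y => ∏ n : Fin N, M.mixTrajProb (alg.policy k D) (y n)) fun k D => ?_
  rw [← Fintype.sum_pow, (M.mixTrajProb_mem_stdSimplex _).2, one_pow]

theorem Scheme.sum_dataProb_mul_prod_le_one
    (F : (k : Fin m) → (Fin k → Fin N → Traj S A H) → Traj S A H → ℝ)
    (hF : ∀ k D τ, 0 ≤ F k D τ)
    (hmean : ∀ k D, ∑ τ, M.mixTrajProb (alg.policy k D) τ * F k D τ ≤ 1) :
    ∑ D, alg.dataProb M D * ∏ k, ∏ n, F k (Fin.take k k.isLt.le D) (D k n) ≤ 1 := by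
  have hnonneg : ∀ k D τ, 0 ≤ M.mixTrajProb (alg.policy k D) τ * F k D τ := fun k D τ =>
    mul_nonneg ((M.mixTrajProb_mem_stdSimplex _).1 τ) (hF k D τ)
  have hbatch := sum_prod_take_le_one
    (fun k D y => ∏ n : Fin N, M.mixTrajProb (alg.policy k D) (y n) * F k D (y n))
    (fun k D y => Finset.prod_nonneg fun n _ => hnonneg k D (y n))
    (fun k D => (Fintype.sum_pow _ N).symm.trans_le
      (pow_le_one₀ (Finset.sum_nonneg fun τ _ => hnonneg k D τ) (hmean k D)))
  simp only [Finset.prod_mul_distrib] at hbatch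
  exact hbatch

theorem Scheme.prob_le_exp_neg_of_exp_le_prod
    (F : (k : Fin m) → (Fin k → Fin N → Traj S A H) → Traj S A H → ℝ)
    (hF : ∀ k D τ, 0 ≤ F k D τ)
    (hmean : ∀ k D, ∑ τ, M.mixTrajProb (alg.policy k D) τ * F k D τ ≤ 1)
    {E : Set (Fin m → Fin N → Traj S A H)} {u : ℝ}
    (hE : ∀ D ∈ E, Real.exp u ≤ ∏ k, ∏ n, F k (Fin.take k k.isLt.le D) (D k n)) :
    alg.prob M E ≤ Real.exp (-u) := by
  rw [Real.exp_neg, ← one_div, le_div_iff₀ (Real.exp_pos u)]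
  refine le_trans ?_ (alg.sum_dataProb_mul_prod_le_one M F hF hmean)
  rw [Scheme.prob, Finset.sum_mul]
  refine Finset.sum_le_sum fun D _ => ?_
  have hD := (alg.dataProb_mem_stdSimplex M).1 D
  by_cases hmem : D ∈ E
  · rw [Set.indicator_of_mem hmem]
    exact mul_le_mul_of_nonneg_left (hE D hmem) hD
  · rw [Set.indicator_of_notMem hmem, zero_mul]
    exact mul_nonneg hD (Finset.prod_nonneg fun _ _ => Finset.prod_nonneg fun _ _ => hF _ _ _)

theorem Scheme.prob_le_sum_prob_of_subset_iUnion {J : Type*} [Fintype J]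
    {B : Set (Fin m → Fin N → Traj S A H)} {E : J → Set (Fin m → Fin N → Traj S A H)}
    (hB : B ⊆ ⋃ i, E i) : alg.prob M B ≤ ∑ i, alg.prob M (E i) := by
  have hnonneg : ∀ i D, 0 ≤ (E i).indicator (alg.dataProb M) D := fun i D =>
    Set.indicator_nonneg (fun D _ => (alg.dataProb_mem_stdSimplex M).1 D) D
  unfold Scheme.prob
  rw [Finset.sum_comm]
  refine Finset.sum_le_sum fun D _ => ?_
  refine Set.indicator_apply_le' (fun hD => ?_) fun _ =>
    Finset.sum_nonneg fun i _ => hnonneg i D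
  obtain ⟨i, hi⟩ := Set.mem_iUnion.1 (hB hD)
  rw [← Set.indicator_of_mem hi (alg.dataProb M)]
  exact Finset.single_le_sum (f := fun i => (E i).indicator (alg.dataProb M) D)
    (fun i _ => hnonneg i D) (Finset.mem_univ i)

theorem Scheme.one_sub_le_prob_of_compl_subset_union
    {E B B' : Set (Fin m → Fin N → Traj S A H)} (hE : Eᶜ ⊆ B ∪ B') :
    1 - (alg.prob M B + alg.prob M B') ≤ alg.prob M E := by
  have hcover : (⋃ i, ![E, B, B'] i) = Set.univ := by
    refine Set.eq_univ_of_forall fun D => Set.mem_iUnion.2 ?_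
    by_cases hD : D ∈ E
    · exact ⟨0, hD⟩
    · exact (hE hD).elim (fun h => ⟨1, h⟩) fun h => ⟨2, h⟩
  have hsum := alg.prob_le_sum_prob_of_subset_iUnion M hcover.ge
  have huniv : alg.prob M Set.univ = 1 := by
    simpa only [Scheme.prob, Set.indicator_univ] using (alg.dataProb_mem_stdSimplex M).2
  simp only [huniv, Fin.sum_univ_three, Matrix.cons_val] at hsum
  linarith

end DataLaw

section ExponentialMoments

variable {Ω : Type*} [Fintype Ω] {p f : Ω → ℝ}

theorem sum_mul_exp_half_mean_sub_le_one (hp : p ∈ stdSimplex ℝ Ω)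
    (hf : ∀ ω, f ω ∈ Set.Icc (0 : ℝ) 1) :
    ∑ ω, p ω * Real.exp ((∑ ω', p ω' * f ω') / 2 - f ω * Real.log 2) ≤ 1 := by
  set μ := ∑ ω', p ω' * f ω'
  have hpow : ∀ ω, Real.exp (-(f ω * Real.log 2)) ≤ 1 - f ω / 2 := by
    intro ω
    have hbernoulli := rpow_one_add_le_one_add_mul_self (s := -(1 / 2)) (by norm_num)
      (hf ω).1 (hf ω).2
    rw [Real.rpow_def_of_pos (by norm_num), show (1 : ℝ) + -(1 / 2) = 2⁻¹ by norm_num,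
      Real.log_inv] at hbernoulli
    calc Real.exp (-(f ω * Real.log 2)) = Real.exp (-Real.log 2 * f ω) := by ring_nf
      _ ≤ 1 + f ω * -(1 / 2) := hbernoulli
      _ = 1 - f ω / 2 := by ring
  calc ∑ ω, p ω * Real.exp (μ / 2 - f ω * Real.log 2)
      ≤ ∑ ω, p ω * (Real.exp (μ / 2) * (1 - f ω / 2)) := by
        refine Finset.sum_le_sum fun ω _ => mul_le_mul_of_nonneg_left ?_ (hp.1 ω)
        rw [sub_eq_add_neg, Real.exp_add]
        exact mul_le_mul_of_nonneg_left (hpow ω) (Real.exp_nonneg _)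
    _ = Real.exp (μ / 2) * ∑ ω, (p ω - p ω * f ω / 2) := by
        rw [Finset.mul_sum]
        exact Finset.sum_congr rfl fun ω _ => by ring
    _ = Real.exp (μ / 2) * (1 - μ / 2) := by
        rw [Finset.sum_sub_distrib, ← Finset.sum_div, hp.2]
    _ ≤ Real.exp (μ / 2) * Real.exp (-(μ / 2)) :=
        mul_le_mul_of_nonneg_left (Real.one_sub_le_exp_neg _) (Real.exp_nonneg _)
    _ = 1 := by rw [← Real.exp_add, add_neg_cancel, Real.exp_zero]

theorem sum_mul_exp_mul_sub_mean_sub_sq_le_one (hp : p ∈ stdSimplex ℝ Ω)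
    (hf : ∀ ω, f ω ∈ Set.Icc (0 : ℝ) 1) {l : ℝ} (hl : |l| ≤ 1) :
    ∑ ω, p ω * Real.exp (l * (f ω - ∑ ω', p ω' * f ω') - l ^ 2) ≤ 1 := by
  set μ := ∑ ω', p ω' * f ω' with hμ
  have hμ01 : μ ∈ Set.Icc (0 : ℝ) 1 := sum_mul_mem_Icc_of_mem_stdSimplex hp hf
  have hexp : ∀ ω, Real.exp (l * (f ω - μ)) ≤ 1 + l * (f ω - μ) + l ^ 2 := by
    intro ω
    have hdiff : |f ω - μ| ≤ 1 :=
      abs_le.2 ⟨by linarith [(hf ω).1, hμ01.2], by linarith [(hf ω).2, hμ01.1]⟩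
    have hy : |l * (f ω - μ)| ≤ |l| := by
      rw [abs_mul]
      exact mul_le_of_le_one_right (abs_nonneg l) hdiff
    have hquad := (abs_le.1 (Real.abs_exp_sub_one_sub_id_le (hy.trans hl))).2
    linarith [sq_le_sq.2 hy]
  have hmean : ∑ ω, p ω * (1 + l * (f ω - μ) + l ^ 2) = 1 + l ^ 2 := by
    calc ∑ ω, p ω * (1 + l * (f ω - μ) + l ^ 2)
        = ∑ ω, ((1 + l ^ 2 - l * μ) * p ω + l * (p ω * f ω)) :=
          Finset.sum_congr rfl fun ω _ => by ring
      _ = 1 + l ^ 2 := by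
          rw [Finset.sum_add_distrib, ← Finset.mul_sum, ← Finset.mul_sum, hp.2, ← hμ]
          ring
  calc ∑ ω, p ω * Real.exp (l * (f ω - μ) - l ^ 2)
      ≤ ∑ ω, p ω * (1 + l * (f ω - μ) + l ^ 2) * Real.exp (-l ^ 2) := by
        refine Finset.sum_le_sum fun ω _ => ?_
        rw [sub_eq_add_neg _ (l ^ 2), Real.exp_add, mul_assoc]
        exact mul_le_mul_of_nonneg_left
          (mul_le_mul_of_nonneg_right (hexp ω) (Real.exp_nonneg _)) (hp.1 ω)
    _ = (1 + l ^ 2) * Real.exp (-l ^ 2) := by rw [← Finset.sum_mul, hmean]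
    _ ≤ Real.exp (l ^ 2) * Real.exp (-l ^ 2) :=
        mul_le_mul_of_nonneg_right (by linarith [Real.add_one_le_exp (l ^ 2)]) (Real.exp_nonneg _)
    _ = 1 := by rw [← Real.exp_add, add_neg_cancel, Real.exp_zero]

end ExponentialMoments

section Concentration

variable {S A : Type*} [Fintype S] [DecidableEq S] [Fintype A] [DecidableEq A] {H m N : ℕ}

theorem Scheme.prob_visits_lt (alg : Scheme S A H m N) (M : MDP S A H) (k : Fin m) (h : Fin H)
    (x : S × A) (q : ℝ) :
    alg.prob M {D | q ≤ M.mixOcc (alg.deployed D k) h x ∧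
      visits (D k) h x < N * M.mixOcc (alg.deployed D k) h x / 2} ≤ Real.exp (-(N * q / 8)) := by
  refine alg.prob_le_exp_neg_of_exp_le_prod M (fun k' D τ => if k' = k then
    Real.exp (M.mixOcc (alg.policy k' D) h x / 2 - (if τ h = x then 1 else 0) * Real.log 2)
    else 1) ?_ ?_ ?_
  · intro k' D τ
    split_ifs <;> positivity
  · intro k' D
    split_ifs
    · rw [M.mixOcc_eq_sum_mixTrajProb]
      refine sum_mul_exp_half_mean_sub_le_one (M.mixTrajProb_mem_stdSimplex _) fun τ => ?_
      split_ifs <;> simp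
    · simp only [mul_one, (M.mixTrajProb_mem_stdSimplex _).2, le_refl]
  · rintro D ⟨hq, hlt⟩
    set p := M.mixOcc (alg.deployed D k) h x
    have hlog : visits (D k) h x * Real.log 2 ≤ N * p / 2 * (3 / 4) :=
      mul_le_mul hlt.le (by linarith [Real.log_two_lt_d9]) (Real.log_nonneg one_le_two)
        ((visits_nonneg _ _ _).trans hlt.le)
    have hNq : (N : ℝ) * q ≤ N * p := mul_le_mul_of_nonneg_left hq (Nat.cast_nonneg _)
    rw [Finset.prod_eq_single k (fun k' _ hk' => by simp [hk']) (by simp)]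
    simp only [if_true, ← Real.exp_sum, Finset.sum_sub_distrib, ← Finset.sum_mul]
    change _ ≤ Real.exp (∑ _ : Fin N, p / 2 - visits (D k) h x * Real.log 2)
    rw [Finset.sum_const, Finset.card_univ, Fintype.card_fin, nsmul_eq_mul]
    exact Real.exp_le_exp.2 (by linarith)

/-- Exponent of the transition supermartingale, collected along one trajectory: in layer `j` it
follows the next value of `V j` after a visit to `x j`, with inverse temperature `l j`. -/
def MDP.score (M : MDP S A H) (x : Fin H → S × A) (V : Fin H → S → ℝ) (l : Fin H → ℝ)
    (τ : Traj S A H) : ℝ :=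
  ∑ j, if τ j = x j then l j * (nextValue τ j (V j) - M.nextMean j (x j) (V j)) - l j ^ 2 else 0

theorem MDP.expect_exp_score_le_one (M : MDP S A H) (π : Policy S A H) (x : Fin H → S × A)
    {V : Fin H → S → ℝ} (hV : ∀ j s, V j s ∈ Set.Icc (0 : ℝ) 1) {l : Fin H → ℝ}
    (hl : ∀ j, |l j| ≤ 1) : M.expect π (fun τ => Real.exp (M.score x V l τ)) ≤ 1 := by
  let G : Fin H → S × A → S → ℝ := fun j y s => Real.exp (if y = x j then
    l j * (V j s - ∑ s', M.P j y.1 y.2 s' * V j s') - l j ^ 2 else 0)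
  refine le_trans (Finset.sum_le_sum fun τ _ =>
    mul_le_mul_of_nonneg_left ?_ (M.trajProb_nonneg π τ))
    (M.expect_transProd_le_one π (G := G) (fun j y s => Real.exp_nonneg _) fun j y => ?_)
  · simp only [MDP.score, Real.exp_sum, transProd]
    refine Finset.prod_le_prod (fun j _ => Real.exp_nonneg _) fun j _ => ?_
    by_cases hj : j.val + 1 < H
    · simp only [nextValue, MDP.nextMean, dif_pos hj, if_pos hj, G]
      split_ifs with hx
      · rw [hx]
      · rfl
    · simp only [nextValue, MDP.nextMean, dif_neg hj, if_neg hj, sub_self, mul_zero, zero_sub,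
        Real.exp_le_one_iff]
      split_ifs
      · exact neg_nonpos.2 (sq_nonneg _)
      · exact le_rfl
  · by_cases hy : y = x j
    · simpa only [G, if_pos hy] using
        sum_mul_exp_mul_sub_mean_sub_sq_le_one (M.P_mem j y.1 y.2) (hV j) (hl j)
    · simp only [G, if_neg hy, Real.exp_zero, mul_one, (M.P_mem j y.1 y.2).2, le_refl]

omit [Fintype A] in
theorem MDP.sum_score_pool (M : MDP S A H) {k : ℕ} (D : Fin k → Fin N → Traj S A H)
    (x : Fin H → S × A) (V : Fin H → S → ℝ) (l : Fin H → ℝ) :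
    ∑ i, ∑ n, M.score x V l (D i n) =
      ∑ j, (l j * M.deviation (pool D) j (x j) (V j) - l j ^ 2 * visits (pool D) j (x j)) := by
  rw [← Fintype.sum_prod_type' fun i n => M.score x V l (D i n)]
  unfold MDP.score
  rw [Finset.sum_comm]
  refine Finset.sum_congr rfl fun j _ => ?_
  rw [M.deviation_apply, visits, Finset.mul_sum, Finset.mul_sum, ← Finset.sum_sub_distrib]
  refine Finset.sum_congr rfl fun p _ => ?_
  by_cases hp : D p.1 p.2 j = x j <;> simp [pool, hp, mul_sub]

theorem Scheme.prob_score_ge (alg : Scheme S A H m N) (M : MDP S A H) {k : ℕ} (hk : k ≤ m)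
    (x : Fin H → S × A) {V : Fin H → S → ℝ} (hV : ∀ j s, V j s ∈ Set.Icc (0 : ℝ) 1)
    {l : Fin H → ℝ} (hl : ∀ j, |l j| ≤ 1) (u : ℝ) :
    alg.prob M {D | u ≤ ∑ j, (l j * M.deviation (pool (Fin.take k hk D)) j (x j) (V j) -
        l j ^ 2 * visits (pool (Fin.take k hk D)) j (x j))} ≤ Real.exp (-u) := by
  refine alg.prob_le_exp_neg_of_exp_le_prod M
    (fun i _ τ => if i.val < k then Real.exp (M.score x V l τ) else 1) ?_ ?_ ?_
  · intro i _ τ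
    split_ifs <;> positivity
  · intro i D
    split_ifs
    · rw [M.sum_mixTrajProb_mul]
      exact (sum_mul_mem_Icc_of_mem_stdSimplex (alg.policy i D).2 fun π =>
        ⟨Finset.sum_nonneg fun τ _ => mul_nonneg (M.trajProb_nonneg _ τ) (Real.exp_nonneg _),
          M.expect_exp_score_le_one π.toPolicy x hV hl⟩).2
    · simp only [mul_one, (M.mixTrajProb_mem_stdSimplex _).2, le_refl]
  · intro D hD
    obtain ⟨r, rfl⟩ := Nat.exists_eq_add_of_le hk
    simp only [Set.mem_ofPred_eq, ← M.sum_score_pool] at hD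
    simp only [Fin.prod_univ_add, Fin.val_castAdd, Fin.is_lt, if_true, Fin.val_natAdd,
      not_lt.2 (Nat.le_add_right k _), if_false, Finset.prod_const_one, mul_one, ← Real.exp_sum]
    exact Real.exp_le_exp.2 hD

end Concentration

section Coverage

variable {S A : Type*} [Fintype S] [DecidableEq S] [Fintype A] [DecidableEq A] {H N : ℕ}

theorem MDP.pos_and_nonempty_of_dm_pos (M : MDP S A H) (h : 0 < M.dm) : 0 < H ∧ Nonempty A := by
  constructor
  · rcases Nat.eq_zero_or_pos H with rfl | hH
    · simp [MDP.dm] at h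
    · exact hH
  · by_contra hA
    rw [not_nonempty_iff] at hA
    have (h : Fin H) : IsEmpty (layerPairs (A := A) M.s₁ h) := ⟨fun x => hA.elim x.1.2⟩
    simp [MDP.dm] at h

omit [Fintype S] [DecidableEq S] [DecidableEq A] in
theorem nonempty_policy [Nonempty A] : Nonempty (Policy S A H) := by
  classical
  exact ⟨DetPolicy.toPolicy fun _ _ => Classical.arbitrary A⟩

theorem MDP.exists_le_mixOcc_of_lt_dm [Nonempty A] (M : MDP S A H) {c : ℝ} (hc : c < M.dm)
    (h : Fin H) : ∃ w : Mixture S A H, ∀ x ∈ layerPairs M.s₁ h, c ≤ M.mixOcc w h x := by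
  have := nonempty_policy (S := S) (A := A) (H := H)
  obtain ⟨π, hπ⟩ := exists_lt_of_lt_ciSup (hc.trans_le (ciInf_le (Finite.bddBelow_range _) h))
  obtain ⟨w, hw⟩ := M.exists_mixOcc_eq_occ π h
  refine ⟨w, fun x hx => ?_⟩
  rw [hw]
  exact hπ.le.trans (ciInf_le (Finite.bddBelow_range
    fun x : layerPairs (A := A) M.s₁ h => M.occ π h x.1) ⟨x, hx⟩)

theorem MDP.dm_le_one (M : MDP S A H) : M.dm ≤ 1 := by
  by_contra! hdm
  obtain ⟨hH, hA⟩ := M.pos_and_nonempty_of_dm_pos (one_pos.trans hdm)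
  obtain ⟨c, hc, hcdm⟩ := exists_between hdm
  obtain ⟨w, hw⟩ := M.exists_le_mixOcc_of_lt_dm hcdm ⟨0, hH⟩
  have hstart : (M.s₁, Classical.arbitrary A) ∈ layerPairs M.s₁ (⟨0, hH⟩ : Fin H) := by
    simp [layerPairs]
  exact absurd ((hw _ hstart).trans (M.mixOcc_mem_Icc w _ _).2) hc.not_ge

theorem MDP.abs_estOccMix_sub_mixOcc_le {I : Type*} [Fintype I] (M : MDP S A H)
    (D : I → Traj S A H) (h : Fin H) {e : ℝ} {x : S × A}
    (he : ∀ π, |estOcc D M.s₁ h π x - M.occ (DetPolicy.toPolicy π) h x| ≤ e)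
    (w : Mixture S A H) : |estOccMix D M.s₁ h w x - M.mixOcc w h x| ≤ e :=
  (abs_sum_mul_sub_sum_mul_le w.2.1 _ _).trans
    (sum_mul_mem_Icc_of_mem_stdSimplex w.2 fun π => ⟨abs_nonneg _, he π⟩).2

/-- The mixture `w` covers layer `h`: it reaches every pair of the layer with probability at
least `η / 2`, and the occupancies of any other policy relative to it sum to at most `3SA`. -/
def MDP.Covers (M : MDP S A H) (η : ℝ) (h : Fin H) (w : Mixture S A H) : Prop :=
  (∀ x ∈ layerPairs M.s₁ h, η / 2 ≤ M.mixOcc w h x) ∧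
    ∀ π : DetPolicy S A H, ∑ x ∈ layerPairs M.s₁ h,
      M.occ (DetPolicy.toPolicy π) h x / M.mixOcc w h x ≤ 3 * (Fintype.card S * Fintype.card A)

theorem div_le_of_abs_sub_le_eighth {p q p' q' η : ℝ} (hη : 0 < η) (hp : 0 ≤ p) (hq' : η ≤ q')
    (hpp : |p' - p| ≤ η / 8) (hqq : |q' - q| ≤ η / 8) :
    p / q ≤ 8 / 7 * (p' / q') + 1 / 7 := by
  have hp' := (abs_le.1 hpp).1
  have hq := (abs_le.1 hqq).2
  have hq'0 : 0 < q' := hη.trans_le hq'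
  calc p / q ≤ p / (7 / 8 * q') :=
        div_le_div_of_nonneg_left hp (by positivity) (by linarith)
    _ ≤ (p' + q' / 8) / (7 / 8 * q') := by gcongr; linarith
    _ = 8 / 7 * (p' / q') + 1 / 7 := by field_simp

theorem IsDesignSolution.covers {I : Type*} [Fintype I] [Nonempty A] {M : MDP S A H}
    {D : I → Traj S A H} {η : ℝ} {h : Fin H} {w : Mixture S A H}
    (hw : IsDesignSolution D M.s₁ η h w) (hη : 0 < η) (hdm : 5 * η ≤ M.dm)
    (he : ∀ π x, |estOcc D M.s₁ h π x - M.occ (DetPolicy.toPolicy π) h x| ≤ η / 8) :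
    M.Covers η h w := by
  have hmix := fun w x => M.abs_estOccMix_sub_mixOcc_le D h (fun π => he π x) w
  refine ⟨fun x hx => by linarith [hw.1 x hx, (abs_le.1 (hmix w x)).2], fun π => ?_⟩
  obtain ⟨u, hu⟩ := M.exists_le_mixOcc_of_lt_dm (show 4 * η < M.dm by linarith) h
  have hfeas : IsFeasible D M.s₁ (2 * η) h u := fun x hx => by
    linarith [hu x hx, (abs_le.1 (hmix u x)).1]
  have hcard : ((layerPairs (A := A) M.s₁ h).card : ℝ) ≤ Fintype.card S * Fintype.card A := by
    exact_mod_cast (Finset.card_le_univ _).trans_eq (Fintype.card_prod S A)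
  calc ∑ x ∈ layerPairs M.s₁ h, M.occ (DetPolicy.toPolicy π) h x / M.mixOcc w h x
      ≤ ∑ x ∈ layerPairs M.s₁ h,
          (8 / 7 * (estOcc D M.s₁ h π x / estOccMix D M.s₁ h w x) + 1 / 7) :=
        Finset.sum_le_sum fun x hx => div_le_of_abs_sub_le_eighth hη
          ((M.occ_mem_stdSimplex _ h).1 x) (hw.1 x hx) (he π x) (hmix w x)
    _ = 8 / 7 * ∑ x ∈ layerPairs M.s₁ h, estOcc D M.s₁ h π x / estOccMix D M.s₁ h w x +
          (layerPairs (A := A) M.s₁ h).card * (1 / 7) := by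
        rw [Finset.sum_add_distrib, ← Finset.mul_sum, Finset.sum_const, nsmul_eq_mul]
    _ ≤ 3 * (Fintype.card S * Fintype.card A) := by
        linarith [hw.sum_div_le hη hfeas π, (layerPairs (A := A) M.s₁ h).card.cast_nonneg (α := ℝ)]

theorem Scheme.IsLayerwiseExploration.covers [Nonempty A] {alg : Scheme S A H H N} {M : MDP S A H}
    {η : ℝ} (halg : alg.IsLayerwiseExploration M.s₁ η) (hη : 0 < η) (hdm : 5 * η ≤ M.dm)
    (D : Fin H → Fin N → Traj S A H) (h : Fin H)
    (he : ∀ π x, |estOcc (pool (Fin.take h h.isLt.le D)) M.s₁ h π x -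
      M.occ (DetPolicy.toPolicy π) h x| ≤ η / 8) :
    M.Covers η h (alg.deployed D h) := by
  obtain ⟨u, hu⟩ := M.exists_le_mixOcc_of_lt_dm (show 4 * η < M.dm by linarith) h
  have hfeas : IsFeasible (pool (Fin.take h h.isLt.le D)) M.s₁ η h u := fun x hx => by
    linarith [hu x hx, (abs_le.1 (M.abs_estOccMix_sub_mixOcc_le _ h (fun π => he π x) u)).1]
  have hsol : IsDesignSolution (pool (Fin.take h h.isLt.le D)) M.s₁ η h (alg.deployed D h) :=
    halg h _ (exists_isDesignSolution _ M.s₁ hη h hfeas)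
  exact hsol.covers hη hdm he

end Coverage

section LocalErrors

/-- Inverse temperature of the supermartingale that is suited to a visitation probability
between `g * η / 2` and `g * η`; it vanishes at `g = 0`, where the division returns `0`. -/
def temp (N : ℕ) (η L : ℝ) (g : ℕ) : ℝ := √(2 * L / (N * η * g))

theorem abs_temp_le_one {N : ℕ} {η L : ℝ} (hNη : 0 ≤ N * η) (hLN : 2 * L ≤ N * η) (g : ℕ) :
    |temp N η L g| ≤ 1 := by
  rw [temp, abs_of_nonneg (Real.sqrt_nonneg _), Real.sqrt_le_one]
  rcases Nat.eq_zero_or_pos g with rfl | hg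
  · simp
  · have hg1 : (1 : ℝ) ≤ g := by exact_mod_cast hg
    exact div_le_one_of_le₀ (hLN.trans (le_mul_of_one_le_right hNη hg1)) (by positivity)

theorem exists_natCast_mul_mem_Icc {η p : ℝ} (hη : 0 < η) (hp : η / 2 ≤ p) (hp1 : p ≤ 1) :
    ∃ g < ⌊2 / η⌋₊ + 1, (g * η : ℝ) ∈ Set.Icc p (2 * p) := by
  have hratio : (1 : ℝ) ≤ 2 * p / η := by rw [le_div_iff₀ hη]; linarith
  refine ⟨⌊2 * p / η⌋₊, Nat.lt_succ_of_le (Nat.floor_le_floor (by gcongr; linarith)), ?_, ?_⟩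
  · have hfloor : (1 : ℝ) ≤ ⌊2 * p / η⌋₊ := by exact_mod_cast Nat.le_floor (by simpa using hratio)
    have hlt := Nat.lt_floor_add_one (2 * p / η)
    rw [div_lt_iff₀ hη] at hlt
    linarith [mul_le_mul_of_nonneg_right hfloor hη.le]
  · rw [← le_div_iff₀ hη]
    exact Nat.floor_le (by linarith)

theorem exists_temp_mem_Icc {N : ℕ} {η L p : ℝ} (hη : 0 < η) (hL : 0 ≤ L) (hN : 0 < (N : ℝ))
    (hp : η / 2 ≤ p) (hp1 : p ≤ 1) :
    ∃ g < ⌊2 / η⌋₊ + 1, temp N η L g ∈ Set.Icc √(L / (N * p)) (2 * √(L / (N * p))) := by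
  have hp0 : 0 < p := by linarith
  obtain ⟨g, hg, hpg, hgp⟩ := exists_natCast_mul_mem_Icc hη hp hp1
  have hgη : 0 < g * η := hp0.trans_le hpg
  have htemp : temp N η L g = √(2 * L / (N * (g * η))) := by rw [temp, mul_assoc, mul_comm η]
  refine ⟨g, hg, ?_, ?_⟩
  · rw [htemp]
    refine Real.sqrt_le_sqrt ?_
    calc L / (N * p) = 2 * L / (N * (2 * p)) := by field_simp
      _ ≤ 2 * L / (N * (g * η)) := by gcongr
  · rw [htemp, show (2 : ℝ) * √(L / (N * p)) = √(2 ^ 2 * (L / (N * p))) by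
      rw [Real.sqrt_mul (by positivity), Real.sqrt_sq two_pos.le]]
    refine Real.sqrt_le_sqrt ?_
    calc 2 * L / (N * (g * η)) ≤ 2 * L / (N * p) := by gcongr
      _ ≤ 2 ^ 2 * (L / (N * p)) := by
        rw [mul_div_assoc]
        exact mul_le_mul_of_nonneg_right (by norm_num) (by positivity)

theorem add_one_div_one_add_le {L Y q n d l : ℝ} (hL : 1 ≤ L) (hY : 0 ≤ Y) (hLq : L ≤ q)
    (hn : q / 2 ≤ n) (hl : l ∈ Set.Icc √(L / q) (2 * √(L / q))) (h : l * d - l ^ 2 * n ≤ Y) :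
    (d + 1) / (1 + n) ≤ (2 * Y / L + 4) * √(L / q) := by
  have hL0 : 0 < L := one_pos.trans_le hL
  have hq : 0 < q := hL0.trans_le hLq
  have hn0 : 0 < n := (half_pos hq).trans_le hn
  set z := √(L / q) with hz
  have hz0 : 0 < z := Real.sqrt_pos.2 (div_pos hL0 hq)
  have hz1 : z ≤ 1 := Real.sqrt_le_one.2 (div_le_one_of_le₀ hLq hq.le)
  have hl0 : 0 < l := hz0.trans_le hl.1
  have hzn : L ≤ z * (2 * z * n) := by
    have hzq : z ^ 2 * q = L := by rw [hz, Real.sq_sqrt (by positivity), div_mul_cancel₀ _ hq.ne']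
    nlinarith [sq_nonneg z]
  have hone : 1 ≤ 2 * z * n := by
    linarith [mul_le_of_le_one_left (by positivity : 0 ≤ 2 * z * n) hz1]
  have hinv : 1 / l ≤ 2 * z * n / L := by
    refine (one_div_le_one_div_of_le hz0 hl.1).trans ?_
    rwa [div_le_div_iff₀ hz0 hL0, one_mul, mul_comm]
  have hd : d ≤ Y * (1 / l) + l * n := by
    rw [mul_one_div, ← sub_le_iff_le_add, le_div_iff₀ hl0]
    linarith
  rw [div_le_iff₀ (by linarith)]
  calc d + 1 ≤ Y * (2 * z * n / L) + 2 * z * n + 2 * z * n := by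
        linarith [mul_le_mul_of_nonneg_left hinv hY, mul_le_mul_of_nonneg_right hl.2 hn0.le]
    _ = (2 * Y / L + 4) * z * n := by ring
    _ ≤ (2 * Y / L + 4) * z * (1 + n) := by gcongr; linarith

theorem sum_mul_sqrt_div_le {X : Type*} (s : Finset X) {d p : X → ℝ} {L N B : ℝ} (hL : 0 ≤ L)
    (hN : 0 ≤ N) (hd : ∀ x ∈ s, 0 ≤ d x) (hp : ∀ x ∈ s, 0 ≤ p x) (hsum : ∑ x ∈ s, d x ≤ 1)
    (hB : ∑ x ∈ s, d x / p x ≤ B) :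
    ∑ x ∈ s, d x * √(L / (N * p x)) ≤ √(L * B / N) := by
  have hsplit : ∀ x ∈ s, d x * √(L / (N * p x)) = √(d x) * √(L / N * (d x / p x)) := by
    intro x hx
    have harg : L / N * (d x / p x) = d x * (L / (N * p x)) := by
      rw [div_mul_div_comm, mul_comm L, mul_div_assoc]
    rw [harg, Real.sqrt_mul (hd x hx), ← mul_assoc, Real.mul_self_sqrt (hd x hx)]
  have hratio : ∀ x ∈ s, 0 ≤ L / N * (d x / p x) := fun x hx =>
    mul_nonneg (div_nonneg hL hN) (div_nonneg (hd x hx) (hp x hx))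
  calc ∑ x ∈ s, d x * √(L / (N * p x))
      = ∑ x ∈ s, √(d x) * √(L / N * (d x / p x)) := Finset.sum_congr rfl hsplit
    _ ≤ √(∑ x ∈ s, √(d x) ^ 2) * √(∑ x ∈ s, √(L / N * (d x / p x)) ^ 2) :=
        Real.sum_mul_le_sqrt_mul_sqrt s _ _
    _ = √(∑ x ∈ s, d x) * √(L / N * ∑ x ∈ s, d x / p x) := by
        rw [Finset.sum_congr rfl fun x hx => Real.sq_sqrt (hd x hx),
          Finset.sum_congr rfl fun x hx => Real.sq_sqrt (hratio x hx), Finset.mul_sum]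
    _ ≤ 1 * √(L / N * B) := by
        gcongr
        exact Real.sqrt_le_one.2 hsum
    _ = √(L * B / N) := by rw [one_mul, mul_div_right_comm]

end LocalErrors

section ErrorAccumulation

variable {S A : Type*} [Fintype S] [DecidableEq S] [DecidableEq A] {H N : ℕ} {η L : ℝ}
variable {I : Type*} [Fintype I] (M : MDP S A H) (D : I → Traj S A H)

/-- Choices of one layer in the union bound: a pair, a set of next states and the index of a
temperature. -/
abbrev Choice (S A : Type*) (η : ℝ) := (S × A) × Finset S × Fin (⌊2 / η⌋₊ + 1)

/-- Contribution of layer `j`, with choice `c`, to the exponent of the transition supermartingale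
of the data `D`. -/
def MDP.exponent (N : ℕ) (L : ℝ) (j : Fin H) (c : Choice S A η) : ℝ :=
  temp N η L c.2.2 * M.deviation D j c.1 ((c.2.1 : Set S).indicator 1) -
    temp N η L c.2.2 ^ 2 * visits D j c.1

/-- The largest contribution of layer `j` to the exponent, over all choices. -/
def MDP.maxExponent (N : ℕ) (η L : ℝ) (j : Fin H) : ℝ :=
  ⨆ c : Choice S A η, M.exponent D N L j c

theorem MDP.exponent_le_maxExponent [Finite A] (N : ℕ) (L : ℝ) (j : Fin H) (c : Choice S A η) :
    M.exponent D N L j c ≤ M.maxExponent D N η L j :=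
  le_ciSup (Finite.bddAbove_range _) c

theorem MDP.maxExponent_nonneg [Finite A] (N : ℕ) (η L : ℝ) (j : Fin H) :
    0 ≤ M.maxExponent D N η L j := by
  rcases isEmpty_or_nonempty A with hA | ⟨⟨a⟩⟩
  · exact (Real.iSup_of_isEmpty _).ge
  · refine le_trans (le_of_eq ?_) (M.exponent_le_maxExponent D N L j ((M.s₁, a), ∅, 0))
    simp [MDP.exponent, temp]

theorem MDP.localErr_le [Finite A] {M : MDP S A H} {D : I → Traj S A H} (hη : 0 < η) (hL : 1 ≤ L)
    (hLN : 2 * L ≤ N * η) {j : Fin H} {x : S × A} {p : ℝ} (hp : η / 2 ≤ p) (hp1 : p ≤ 1)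
    (hvis : N * p / 2 ≤ visits D j x) :
    M.localErr D j x ≤ (2 * M.maxExponent D N η L j / L + 4) * √(L / (N * p)) := by
  have hN : 0 < (N : ℝ) := pos_of_mul_pos_left (by linarith) hη.le
  obtain ⟨g, hg, htemp⟩ := exists_temp_mem_Icc hη (zero_le_one.trans hL) hN hp hp1
  obtain ⟨T, hT⟩ := M.exists_maxDev_eq D j x
  have hexp := M.exponent_le_maxExponent D N L j (x, T, ⟨g, hg⟩)
  rw [MDP.exponent, hT] at hexp
  exact add_one_div_one_add_le hL (M.maxExponent_nonneg D N η L j)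
    (by linarith [mul_le_mul_of_nonneg_left hp hN.le]) hvis htemp hexp

variable [Fintype A]

theorem MDP.Covers.sum_occ_mul_localErr_le {M : MDP S A H} {D : I → Traj S A H} {j : Fin H}
    {w : Mixture S A H} (hcov : M.Covers η j w) (hη : 0 < η) (hL : 1 ≤ L)
    (hLN : 2 * L ≤ N * η)
    (hvis : ∀ x ∈ layerPairs M.s₁ j, N * M.mixOcc w j x / 2 ≤ visits D j x)
    (π : DetPolicy S A H) :
    ∑ x, M.occ (DetPolicy.toPolicy π) j x * M.localErr D j x ≤
      (2 * M.maxExponent D N η L j / L + 4) *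
        √(L * (3 * (Fintype.card S * Fintype.card A)) / N) := by
  have hL0 : 0 ≤ L := zero_le_one.trans hL
  have hocc := M.occ_mem_stdSimplex (DetPolicy.toPolicy π) j
  have hcoeff : 0 ≤ 2 * M.maxExponent D N η L j / L + 4 := by
    have := M.maxExponent_nonneg D N η L j
    positivity
  calc ∑ x, M.occ (DetPolicy.toPolicy π) j x * M.localErr D j x
      = ∑ x ∈ layerPairs M.s₁ j, M.occ (DetPolicy.toPolicy π) j x * M.localErr D j x :=
        (Finset.sum_subset (Finset.subset_univ _) fun x _ hx => by
          rw [M.occ_eq_zero _ hx, zero_mul]).symm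
    _ ≤ ∑ x ∈ layerPairs M.s₁ j, (2 * M.maxExponent D N η L j / L + 4) *
          (M.occ (DetPolicy.toPolicy π) j x * √(L / (N * M.mixOcc w j x))) := by
        refine Finset.sum_le_sum fun x hx => ?_
        rw [mul_left_comm]
        exact mul_le_mul_of_nonneg_left (MDP.localErr_le hη hL hLN (hcov.1 x hx)
          (M.mixOcc_mem_Icc w j x).2 (hvis x hx)) (hocc.1 x)
    _ ≤ _ := by
        rw [← Finset.mul_sum]
        refine mul_le_mul_of_nonneg_left (sum_mul_sqrt_div_le _ hL0 (Nat.cast_nonneg N)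
          (fun x _ => hocc.1 x) (fun x _ => (M.mixOcc_mem_Icc w j x).1) ?_ (hcov.2 π)) hcoeff
        rw [← hocc.2]
        exact Finset.sum_le_sum_of_subset_of_nonneg (Finset.subset_univ _) fun x _ _ => hocc.1 x

omit [Fintype S] [Fintype A] in
theorem visits_le_visits_pool {k : ℕ} (D : Fin k → Fin N → Traj S A H) (i : Fin k) (h : Fin H)
    (x : S × A) : visits (D i) h x ≤ visits (pool D) h x := by
  unfold visits pool
  rw [Fintype.sum_prod_type]
  exact Finset.single_le_sum (f := fun i => visits (D i) h x)
    (fun i _ => visits_nonneg (D i) h x) (Finset.mem_univ i)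

/-- For the data collected before any deployment `k`, and at the end of the exploration, the layers
together contribute less than `H * L` to the exponent, whatever the choices. -/
def MDP.Concentrated (M : MDP S A H) (η L : ℝ) (D : Fin H → Fin N → Traj S A H) : Prop :=
  ∀ k : Fin (H + 1), ∑ j, M.maxExponent (pool (Fin.take k k.is_le D)) N η L j < H * L

/-- Every pair that deployment `j` reaches in layer `j` with probability at least `η / 2` is
visited there at least half as often as expected. -/
def Scheme.WellVisited (alg : Scheme S A H H N) (M : MDP S A H) (η : ℝ)
    (D : Fin H → Fin N → Traj S A H) : Prop :=
  ∀ (j : Fin H) (x : S × A), η / 2 ≤ M.mixOcc (alg.deployed D j) j x →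
    N * M.mixOcc (alg.deployed D j) j x / 2 ≤ visits (D j) j x

variable {alg : Scheme S A H H N} {M} {D : Fin H → Fin N → Traj S A H}

theorem MDP.Concentrated.value_localErr_le (hconc : M.Concentrated η L D)
    (hvis : alg.WellVisited M η D) (hη : 0 < η) (hL : 1 ≤ L) (hLN : 2 * L ≤ N * η)
    (k : Fin (H + 1)) (hcov : ∀ j : Fin H, j.castSucc < k → M.Covers η j (alg.deployed D j))
    (π : DetPolicy S A H) :
    M.value (DetPolicy.toPolicy π) (fun j s a =>
      if j.castSucc < k then M.localErr (pool (Fin.take k k.is_le D)) j (s, a) else 0) ≤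
      6 * H * √(L * (3 * (Fintype.card S * Fintype.card A)) / N) := by
  set D' := pool (Fin.take k k.is_le D)
  set R := √(L * (3 * (Fintype.card S * Fintype.card A)) / N)
  have hL0 : 0 < L := one_pos.trans_le hL
  have hlayer : ∀ j : Fin H, ∑ x : S × A, M.occ (DetPolicy.toPolicy π) j x *
      (if j.castSucc < k then M.localErr D' j x else 0) ≤
      (2 * M.maxExponent D' N η L j / L + 4) * R := by
    intro j
    by_cases hj : j.castSucc < k
    · simp only [if_pos hj]
      refine (hcov j hj).sum_occ_mul_localErr_le hη hL hLN (fun x hx => ?_) π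
      exact (hvis j x ((hcov j hj).1 x hx)).trans
        (visits_le_visits_pool (Fin.take k k.is_le D) ⟨j, hj⟩ j x)
    · have := M.maxExponent_nonneg D' N η L j
      simp only [if_neg hj, mul_zero, Finset.sum_const_zero]
      positivity
  calc _ = ∑ j, ∑ x : S × A, M.occ (DetPolicy.toPolicy π) j x *
          (if j.castSucc < k then M.localErr D' j x else 0) := M.value_eq_sum_occ _ _
    _ ≤ ∑ j, (2 * M.maxExponent D' N η L j / L + 4) * R := Finset.sum_le_sum fun j _ => hlayer j
    _ = (2 * ((∑ j, M.maxExponent D' N η L j) / L) + H * 4) * R := by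
        rw [← Finset.sum_mul, Finset.sum_add_distrib, ← Finset.sum_div, ← Finset.mul_sum,
          mul_div_assoc]
        simp only [Finset.sum_const, Finset.card_univ, Fintype.card_fin, nsmul_eq_mul]
    _ ≤ 6 * H * R := by
        have hsum : (∑ j, M.maxExponent D' N η L j) / L ≤ H := (div_le_iff₀ hL0).2 (hconc k).le
        exact mul_le_mul_of_nonneg_right (by linarith) (Real.sqrt_nonneg _)

end ErrorAccumulation

section Planning

variable {S A : Type*} [Fintype S] [DecidableEq S] [Fintype A] [DecidableEq A] {H N : ℕ}

theorem IsPlanningOutput.isEpsOptimal {I : Type*} [Fintype I] [Nonempty A] {M : MDP S A H}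
    {D : I → Traj S A H} {r : Reward S A H} {e : ℝ}
    (herr : ∀ π : DetPolicy S A H,
      |estimateV D M.s₁ π r - M.value (DetPolicy.toPolicy π) r| ≤ e)
    {π : DetPolicy S A H} (hπ : IsPlanningOutput D M.s₁ r π) :
    M.IsEpsOptimal (2 * e) r (DetPolicy.toPolicy π) := by
  have := nonempty_policy (S := S) (A := A) (H := H)
  rw [MDP.IsEpsOptimal, sub_le_iff_le_add]
  refine ciSup_le fun ρ' => ?_
  obtain ⟨ρ, hρ⟩ := M.exists_value_le_value_toPolicy ρ' r
  linarith [(abs_le.1 (herr ρ)).1, (abs_le.1 (herr π)).2, hπ ρ]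

variable [Nonempty A] {alg : Scheme S A H H N} {M : MDP S A H} {η L : ℝ}
variable {D : Fin H → Fin N → Traj S A H}

theorem Scheme.IsLayerwiseExploration.covers_of_concentrated
    (halg : alg.IsLayerwiseExploration M.s₁ η) (hη : 0 < η) (hdm : 5 * η ≤ M.dm) (hL : 1 ≤ L)
    (hLN : 2 * L ≤ N * η)
    (hbudget : 6 * H * √(L * (3 * (Fintype.card S * Fintype.card A)) / N) ≤ η / 8)
    (hconc : M.Concentrated η L D) (hvis : alg.WellVisited M η D) (j : Fin H) :
    M.Covers η j (alg.deployed D j) := by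
  suffices hcov : ∀ n, ∀ j : Fin H, j.val < n → M.Covers η j (alg.deployed D j) from
    hcov H j j.isLt
  intro n
  induction n with
  | zero => exact fun j hj => absurd hj (Nat.not_lt_zero _)
  | succ n ih =>
    intro j hj
    refine halg.covers hη hdm D j fun π x => (M.abs_estOcc_sub_occ_le _ j π x).trans ?_
    exact (hconc.value_localErr_le hvis hη hL hLN j.castSucc
      (fun i (hi : i.val < j.val) => ih i (hi.trans_le (Nat.lt_succ_iff.1 hj))) π).trans hbudget

theorem Scheme.IsLayerwiseExploration.isEpsOptimal
    (halg : alg.IsLayerwiseExploration M.s₁ η) (hη : 0 < η) (hdm : 5 * η ≤ M.dm) (hL : 1 ≤ L)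
    (hLN : 2 * L ≤ N * η)
    (hbudget : 6 * H * √(L * (3 * (Fintype.card S * Fintype.card A)) / N) ≤ η / 8)
    (hconc : M.Concentrated η L D) (hvis : alg.WellVisited M η D) {r : Reward S A H}
    (hr : IsValidReward r) {π : DetPolicy S A H} (hπ : IsPlanningOutput (pool D) M.s₁ r π) :
    M.IsEpsOptimal (H * η) r (DetPolicy.toPolicy π) := by
  have hcov := halg.covers_of_concentrated hη hdm hL hLN hbudget hconc hvis
  have hlocal : ∀ ρ : DetPolicy S A H, M.value (DetPolicy.toPolicy ρ)
      (fun j s a => M.localErr (pool D) j (s, a)) ≤ η / 8 := by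
    intro ρ
    have hvalue := hconc.value_localErr_le hvis hη hL hLN (Fin.last H) (fun j _ => hcov j) ρ
    simp only [Fin.castSucc_lt_last, if_true] at hvalue
    exact hvalue.trans hbudget
  have herr : ∀ ρ : DetPolicy S A H,
      |estimateV (pool D) M.s₁ ρ r - M.value (DetPolicy.toPolicy ρ) r| ≤ H * (η / 8) := by
    intro ρ
    refine (M.abs_estimateV_sub_value_le (pool D) ρ hr).trans ?_
    rw [M.value_eq_sum_occ]
    simp only [mul_left_comm _ (H : ℝ), ← Finset.mul_sum]
    rw [← M.value_eq_sum_occ _ fun j s a => M.localErr (pool D) j (s, a)]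
    exact mul_le_mul_of_nonneg_left (hlocal ρ) (Nat.cast_nonneg H)
  have hopt := hπ.isEpsOptimal herr
  have hHη : (0 : ℝ) ≤ H * η := by positivity
  unfold MDP.IsEpsOptimal at hopt ⊢
  linarith

end Planning

section Probability

theorem add_one_mul_pow_le_half {n : ℕ} (hn : 0 < n) {K δ : ℝ} (hK : 0 ≤ K) (hKδ : K ≤ δ / 8)
    (hδ : δ ≤ 1) : (n + 1) * K ^ n ≤ δ / 2 := by
  have htwo : (n : ℝ) + 1 ≤ 2 ^ n := by exact_mod_cast Nat.lt_two_pow_self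
  calc (n + 1) * K ^ n ≤ 2 ^ n * (δ / 8) ^ n := by gcongr
    _ = (δ / 4) ^ n := by rw [← mul_pow]; ring_nf
    _ ≤ (δ / 4) ^ 1 := pow_le_pow_of_le_one (by linarith) (by linarith) hn
    _ ≤ δ / 2 := by linarith

variable {S A : Type*} [Fintype S] [DecidableEq S] [Fintype A] [DecidableEq A] {H N : ℕ}
  {η L δ : ℝ}

theorem Scheme.prob_not_concentrated_le [Nonempty A] (alg : Scheme S A H H N) (M : MDP S A H)
    (hH : 0 < H) (hδ : δ ≤ 1) (hL : 0 ≤ L) (hLN : 2 * L ≤ N * η)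
    (hcard : Fintype.card (Choice S A η) * Real.exp (-L) ≤ δ / 8) :
    alg.prob M {D | ¬ M.Concentrated η L D} ≤ δ / 2 := by
  have : Nonempty S := ⟨M.s₁⟩
  let E : Fin (H + 1) × (Fin H → Choice S A η) → Set (Fin H → Fin N → Traj S A H) := fun kc =>
    {D | H * L ≤ ∑ j, M.exponent (pool (Fin.take kc.1 kc.1.is_le D)) N L j (kc.2 j)}
  have hsub : {D | ¬ M.Concentrated η L D} ⊆ ⋃ kc, E kc := by
    intro D hD
    obtain ⟨k, hk⟩ := not_forall.1 hD
    choose c hc using fun j =>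
      exists_eq_ciSup_of_finite (f := M.exponent (η := η) (pool (Fin.take k k.is_le D)) N L j)
    refine Set.mem_iUnion.2 ⟨(k, c), (not_lt.1 hk).trans_eq ?_⟩
    exact Finset.sum_congr rfl fun j _ => (hc j).symm
  have hE : ∀ kc, alg.prob M (E kc) ≤ Real.exp (-L) ^ H := by
    intro kc
    rw [← Real.exp_nat_mul, mul_neg]
    exact alg.prob_score_ge M kc.1.is_le (fun j => (kc.2 j).1)
      (fun j s => ⟨Set.indicator_nonneg (fun _ _ => zero_le_one) s,
        Set.indicator_le_self' (fun _ _ => zero_le_one) s⟩)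
      (fun j => abs_temp_le_one ((mul_nonneg zero_le_two hL).trans hLN) hLN _) _
  calc alg.prob M {D | ¬ M.Concentrated η L D} ≤ ∑ kc, alg.prob M (E kc) :=
        alg.prob_le_sum_prob_of_subset_iUnion M hsub
    _ ≤ ∑ _kc : Fin (H + 1) × (Fin H → Choice S A η), Real.exp (-L) ^ H :=
        Finset.sum_le_sum fun kc _ => hE kc
    _ = (H + 1) * (Fintype.card (Choice S A η) * Real.exp (-L)) ^ H := by
        rw [Finset.sum_const, Finset.card_univ, nsmul_eq_mul, Fintype.card_prod, Fintype.card_fun,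
          Fintype.card_fin, Fintype.card_fin, mul_pow, ← mul_assoc]
        push_cast
        rfl
    _ ≤ δ / 2 := add_one_mul_pow_le_half hH (by positivity) hcard hδ

theorem Scheme.prob_not_wellVisited_le (alg : Scheme S A H H N) (M : MDP S A H)
    (hcard : H * (Fintype.card S * Fintype.card A) * Real.exp (-(N * (η / 2) / 8)) ≤ δ / 2) :
    alg.prob M {D | ¬ alg.WellVisited M η D} ≤ δ / 2 := by
  let E : Fin H × (S × A) → Set (Fin H → Fin N → Traj S A H) := fun jx =>
    {D | η / 2 ≤ M.mixOcc (alg.deployed D jx.1) jx.1 jx.2 ∧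
      visits (D jx.1) jx.1 jx.2 < N * M.mixOcc (alg.deployed D jx.1) jx.1 jx.2 / 2}
  have hsub : {D | ¬ alg.WellVisited M η D} ⊆ ⋃ jx, E jx := by
    intro D hD
    simp only [Scheme.WellVisited, Set.mem_ofPred_eq, not_forall, not_le] at hD
    obtain ⟨j, x, hocc, hvis⟩ := hD
    exact Set.mem_iUnion.2 ⟨(j, x), hocc, hvis⟩
  calc alg.prob M {D | ¬ alg.WellVisited M η D} ≤ ∑ jx, alg.prob M (E jx) :=
        alg.prob_le_sum_prob_of_subset_iUnion M hsub
    _ ≤ ∑ _jx : Fin H × (S × A), Real.exp (-(N * (η / 2) / 8)) :=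
        Finset.sum_le_sum fun jx _ => alg.prob_visits_lt M jx.1 jx.1 jx.2 (η / 2)
    _ = H * (Fintype.card S * Fintype.card A) * Real.exp (-(N * (η / 2) / 8)) := by
        simp only [Finset.sum_const, Finset.card_univ, nsmul_eq_mul, Fintype.card_prod,
          Fintype.card_fin]
        push_cast
        ring
    _ ≤ δ / 2 := hcard

theorem Scheme.IsLayerwiseExploration.one_sub_le_prob [Nonempty A] {alg : Scheme S A H H N}
    {M : MDP S A H} (halg : alg.IsLayerwiseExploration M.s₁ η) (hH : 0 < H) (hη : 0 < η)
    (hdm : 5 * η ≤ M.dm) (hδ : δ ≤ 1) (hL : 1 ≤ L) (hLN : 2 * L ≤ N * η)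
    (hbudget : 6 * H * √(L * (3 * (Fintype.card S * Fintype.card A)) / N) ≤ η / 8)
    (hchoice : Fintype.card (Choice S A η) * Real.exp (-L) ≤ δ / 8)
    (hvisit : H * (Fintype.card S * Fintype.card A) * Real.exp (-(N * (η / 2) / 8)) ≤ δ / 2) :
    1 - δ ≤ alg.prob M {D | ∀ r : Reward S A H, IsValidReward r → ∀ π : DetPolicy S A H,
      IsPlanningOutput (pool D) M.s₁ r π → M.IsEpsOptimal (H * η) r (DetPolicy.toPolicy π)} := by
  have hconc := alg.prob_not_concentrated_le M hH hδ (zero_le_one.trans hL) hLN hchoice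
  have hvis := alg.prob_not_wellVisited_le M hvisit
  refine le_trans (by linarith) (alg.one_sub_le_prob_of_compl_subset_union M
    (B := {D | ¬ M.Concentrated η L D}) (B' := {D | ¬ alg.WellVisited M η D}) fun D hD => ?_)
  by_contra hgood
  obtain ⟨hconcD, hvisD⟩ := not_or.1 hgood
  exact hD fun r hr π hπ =>
    halg.isEpsOptimal hη hdm hL hLN hbudget (not_not.1 hconcD) (not_not.1 hvisD) hr hπ

end Probability

section Parameters

variable {S A H : ℕ} {ε δ : ℝ}

theorem exp_iota (hS : 0 < S) (hA : 0 < A) (hH : 0 < H) (hε : 0 < ε) (hδ : 0 < δ) :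
    Real.exp (iota S A H ε δ) = S * A / (ε / H * δ) := by
  rw [iota, Real.exp_log (by positivity)]
  field_simp

theorem one_le_iota (hS : 0 < S) (hA : 0 < A) (hH : 0 < H) (hε : 0 < ε) (hδ : 0 < δ)
    (hδ1 : δ ≤ 1) (hη : ε / H ≤ 1 / 4) : 1 ≤ iota S A H ε δ := by
  rw [← Real.exp_le_exp, exp_iota hS hA hH hε hδ, le_div_iff₀ (by positivity)]
  have hSA : (1 : ℝ) ≤ S * A := by exact_mod_cast Nat.mul_pos hS hA
  calc Real.exp 1 * (ε / H * δ) ≤ 3 * (1 / 4 * 1) := by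
        gcongr
        exact Real.exp_one_lt_three.le
    _ ≤ S * A := by linarith

theorem threshold_one_one (hS : 0 < S) (hH : 0 < H) (hι : 0 < iota S A H ε δ) :
    threshold 1 1 S A H ε δ = ε / H := by
  unfold threshold epsBar
  field_simp

theorem batchSize_one (C₂ : ℝ) (hS : 0 < S) (hH : 0 < H) (hε : 0 < ε)
    (hι : 0 < iota S A H ε δ) : batchSize 1 C₂ S A H ε δ =
      ⌈C₂ * (S ^ 2 * A * H ^ 2 * iota S A H ε δ ^ 3 / (ε / H) ^ 2)⌉₊ := by
  have hsqrt : √(S : ℝ) ^ 2 = S := Real.sq_sqrt (Nat.cast_nonneg S)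
  unfold batchSize epsBar
  rw [div_pow, mul_pow, mul_pow, mul_pow, hsqrt]
  congr 1
  field_simp

theorem mul_le_batchSize_mul_sq (C₂ : ℝ) (hS : 0 < S) (hH : 0 < H) (hε : 0 < ε)
    (hι : 0 < iota S A H ε δ) :
    C₂ * (S ^ 2 * A * H ^ 2 * iota S A H ε δ ^ 3) ≤ batchSize 1 C₂ S A H ε δ * (ε / H) ^ 2 := by
  rw [batchSize_one C₂ hS hH hε hι, ← div_le_iff₀ (by positivity), mul_div_assoc]
  exact Nat.le_ceil _

theorem horizon_mul_batchSize_le {C₂ C : ℝ} (hC₂ : 0 ≤ C₂) (hC : C₂ + 1 ≤ C) (hS : 0 < S)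
    (hA : 0 < A) (hH : 0 < H) (hε : 0 < ε) (hη : ε / H ≤ 1) (hι : 1 ≤ iota S A H ε δ) :
    H * batchSize 1 C₂ S A H ε δ ≤
      C * (S ^ 2 * A * H ^ 5 / ε ^ 2) * iota S A H ε δ ^ 3 := by
  rw [batchSize_one C₂ hS hH hε (by linarith)]
  set X := (S ^ 2 * A * H ^ 2 * iota S A H ε δ ^ 3 / (ε / H) ^ 2 : ℝ) with hX
  have hSAH : (1 : ℝ) ≤ S ^ 2 * A * H ^ 2 := by exact_mod_cast Nat.succ_le_of_lt (by positivity)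
  have hX1 : 1 ≤ X := by
    rw [hX, one_le_div (by positivity)]
    exact (pow_le_one₀ (by positivity) hη).trans
      (one_le_mul_of_one_le_of_one_le hSAH (one_le_pow₀ hι))
  have hceil : (⌈C₂ * X⌉₊ : ℝ) ≤ C * X := by
    linarith [Nat.ceil_lt_add_one (show 0 ≤ C₂ * X by positivity),
      mul_le_mul_of_nonneg_right hC (zero_le_one.trans hX1)]
  calc H * (⌈C₂ * X⌉₊ : ℝ) ≤ H * (C * X) := by gcongr
    _ = C * (S ^ 2 * A * H ^ 5 / ε ^ 2) * iota S A H ε δ ^ 3 := by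
      rw [hX]
      field_simp

theorem mul_le_batch_mul {s a h ι n η : ℝ} (hs : 1 ≤ s) (ha : 1 ≤ a) (hh : 1 ≤ h) (hι : 1 ≤ ι)
    (hn : 0 ≤ n) (hη : 0 ≤ η) (hη1 : η ≤ 1)
    (hnη : 100000 * (s ^ 2 * a * h ^ 2 * ι ^ 3) ≤ n * η ^ 2) :
    100000 * (s * h * ι) ≤ n * η := by
  have hpow : s * h * ι ≤ s ^ 2 * a * h ^ 2 * ι ^ 3 :=
    calc s * h * ι = s ^ 1 * 1 * h ^ 1 * ι ^ 1 := by ring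
      _ ≤ s ^ 2 * a * h ^ 2 * ι ^ 3 := by gcongr <;> first | assumption | norm_num
  have hsq : n * η ^ 2 ≤ n * η := by
    gcongr
    exact pow_le_of_le_one hη hη1 two_ne_zero
  linarith

theorem six_mul_sqrt_le {s a h ι n η : ℝ} (hs : 0 < s) (ha : 0 < a) (hh : 0 < h) (hι : 1 ≤ ι)
    (hn : 0 < n) (hη : 0 ≤ η) (hnη : 100000 * (s ^ 2 * a * h ^ 2 * ι ^ 3) ≤ n * η ^ 2) :
    6 * h * √(10 * s * ι * (3 * (s * a)) / n) ≤ η / 8 := by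
  have hpow : s ^ 2 * a * h ^ 2 * ι ≤ s ^ 2 * a * h ^ 2 * ι ^ 3 := by
    gcongr
    exact le_self_pow₀ hι three_ne_zero
  have hpos : 0 < s ^ 2 * a * h ^ 2 * ι := by positivity
  refine le_of_sq_le_sq ?_ (by positivity)
  calc (6 * h * √(10 * s * ι * (3 * (s * a)) / n)) ^ 2
      = 1080 * (s ^ 2 * a * h ^ 2 * ι) / n := by
        rw [mul_pow, Real.sq_sqrt (by positivity)]
        ring
    _ ≤ (η / 8) ^ 2 := by
        rw [div_le_iff₀ hn]
        linarith

theorem card_choice_mul_exp_le {S A : Type*} [Fintype S] [Fintype A] {η δ ι : ℝ}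
    (hS : 0 < Fintype.card S) (hη : 0 < η) (hη1 : η ≤ 1) (hδ : 0 < δ) (hι : 1 ≤ ι)
    (hexp : Real.exp ι = Fintype.card S * Fintype.card A / (η * δ)) :
    Fintype.card (Choice S A η) * Real.exp (-(10 * Fintype.card S * ι)) ≤ δ / 8 := by
  set s := Fintype.card S
  have hs : (1 : ℝ) ≤ s := by exact_mod_cast hS
  have hcard : (Fintype.card (Choice S A η) : ℝ) =
      s * Fintype.card A * (2 ^ s * (⌊2 / η⌋₊ + 1)) := by
    simp [s, Choice, Fintype.card_prod]
  have hpairs : (s : ℝ) * Fintype.card A = Real.exp ι * (η * δ) := by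
    rw [hexp]
    field_simp
  have hfloor : (⌊2 / η⌋₊ : ℝ) + 1 ≤ 3 / η := by
    have hinv : 1 ≤ 1 / η := (one_le_div hη).2 hη1
    linarith [Nat.floor_le (show 0 ≤ 2 / η by positivity), add_div 2 1 η,
      show (3 : ℝ) / η = (2 + 1) / η by norm_num]
  have htwo : ∀ n : ℕ, (2 : ℝ) ^ n ≤ Real.exp n := by
    intro n
    rw [← mul_one (n : ℝ), Real.exp_nat_mul]
    exact pow_le_pow_left₀ zero_le_two (by linarith [Real.exp_one_gt_d9]) n
  have hsum : ι + s + (8 : ℕ) ≤ 10 * s * ι := by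
    push_cast
    nlinarith
  rw [Real.exp_neg, ← div_eq_mul_inv, div_le_iff₀ (Real.exp_pos _), hcard, hpairs]
  calc Real.exp ι * (η * δ) * (2 ^ s * (⌊2 / η⌋₊ + 1))
      ≤ Real.exp ι * (η * δ) * (Real.exp s * (3 / η)) := by
        gcongr
        exact htwo s
    _ = δ / 8 * (Real.exp ι * Real.exp s * 24) := by
        field_simp
        ring
    _ ≤ δ / 8 * (Real.exp ι * Real.exp s * Real.exp (8 : ℕ)) := by
        gcongr
        linarith [htwo 8]
    _ = δ / 8 * Real.exp (ι + s + (8 : ℕ)) := by rw [Real.exp_add, Real.exp_add]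
    _ ≤ δ / 8 * Real.exp (10 * s * ι) := by gcongr

theorem mul_exp_neg_le_half {h s η δ ι n : ℝ} (hη : 0 < η) (hη1 : η ≤ 1 / 2) (hδ : 0 < δ)
    (hh : 1 ≤ h) (hι : 1 ≤ ι) (hexp : Real.exp ι = s / (η * δ)) (hn : 32 * (h * ι) ≤ n * η) :
    h * s * Real.exp (-(n * (η / 2) / 8)) ≤ δ / 2 := by
  have hs : s = Real.exp ι * (η * δ) := by
    rw [hexp]
    field_simp
  have hsum : h + ι ≤ n * (η / 2) / 8 := by nlinarith
  calc h * s * Real.exp (-(n * (η / 2) / 8))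
      ≤ Real.exp h * (Real.exp ι * (η * δ)) * Real.exp (-(h + ι)) := by
        rw [hs]
        gcongr
        linarith [Real.add_one_le_exp h]
    _ = η * δ * (Real.exp (h + ι) * Real.exp (-(h + ι))) := by rw [Real.exp_add]; ring
    _ = η * δ := by rw [← Real.exp_add, add_neg_cancel, Real.exp_zero, mul_one]
    _ ≤ δ / 2 := by nlinarith

theorem Scheme.IsLayerwiseExploration.one_sub_le_prob_of_batch {S A : Type*} [Fintype S]
    [DecidableEq S] [Fintype A] [DecidableEq A] [Nonempty A] {H N : ℕ} {alg : Scheme S A H H N}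
    {M : MDP S A H} {η δ ι : ℝ} (halg : alg.IsLayerwiseExploration M.s₁ η) (hH : 0 < H)
    (hη : 0 < η) (hdm : 5 * η ≤ M.dm) (hδ : 0 < δ) (hδ1 : δ ≤ 1) (hι : 1 ≤ ι)
    (hexp : Real.exp ι = Fintype.card S * Fintype.card A / (η * δ))
    (hbatch : 100000 * ((Fintype.card S : ℝ) ^ 2 * Fintype.card A * H ^ 2 * ι ^ 3) ≤ N * η ^ 2) :
    1 - δ ≤ alg.prob M {D | ∀ r : Reward S A H, IsValidReward r → ∀ π : DetPolicy S A H,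
      IsPlanningOutput (pool D) M.s₁ r π → M.IsEpsOptimal (H * η) r (DetPolicy.toPolicy π)} := by
  have hcardS : 0 < Fintype.card S := Fintype.card_pos_iff.2 ⟨M.s₁⟩
  have hS : (1 : ℝ) ≤ Fintype.card S := by exact_mod_cast hcardS
  have hA : (1 : ℝ) ≤ Fintype.card A := by exact_mod_cast Fintype.card_pos (α := A)
  have hH1 : (1 : ℝ) ≤ H := by exact_mod_cast hH
  have hη1 : η ≤ 1 / 4 := by linarith [M.dm_le_one]
  have hN : 0 < (N : ℝ) := pos_of_mul_pos_left (lt_of_lt_of_le (by positivity) hbatch) (sq_nonneg η)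
  have hNη := mul_le_batch_mul hS hA hH1 hι hN.le hη.le (by linarith) hbatch
  have hSι : 1 ≤ Fintype.card S * ι := one_le_mul_of_one_le_of_one_le hS hι
  have hHι : 1 ≤ H * ι := one_le_mul_of_one_le_of_one_le hH1 hι
  have hSHι : Fintype.card S * ι ≤ Fintype.card S * H * ι := by
    rw [mul_right_comm]
    exact le_mul_of_one_le_right (zero_le_one.trans hSι) hH1
  have hHSι : H * ι ≤ Fintype.card S * H * ι := by
    rw [mul_assoc]
    exact le_mul_of_one_le_left (zero_le_one.trans hHι) hS
  exact halg.one_sub_le_prob hH hη hdm hδ1 (L := 10 * Fintype.card S * ι) (by nlinarith)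
    (by linarith)
    (six_mul_sqrt_le (by linarith) (by linarith) (by linarith) hι hN hη.le hbatch)
    (card_choice_mul_exp_le hcardS hη (by linarith) hδ hι hexp)
    (mul_exp_neg_le_half hη (by linarith) hδ hH1 hι hexp (by linarith))

end Parameters

end TabularRF

end

theorem theoremH1_general {S A : Type*} [Fintype S] [DecidableEq S] [Fintype A] [DecidableEq A]
    {H : ℕ} (M : TabularRF.MDP S A H) {ε δ : ℝ} (hε : 0 < ε) (hδ : 0 < δ) (hδ1 : δ ≤ 1)
    (hεdm : ε ≤ H * M.dm / 5)
    (alg : TabularRF.Scheme S A H H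
      (TabularRF.batchSize 1 100000 (Fintype.card S) (Fintype.card A) H ε δ))
    (halg : alg.IsLayerwiseExploration M.s₁
      (TabularRF.threshold 1 1 (Fintype.card S) (Fintype.card A) H ε δ)) :
    1 - δ ≤ alg.prob M
        {D | ∀ r : TabularRF.Reward S A H, TabularRF.IsValidReward r →
          ∀ π : TabularRF.DetPolicy S A H, TabularRF.IsPlanningOutput (TabularRF.pool D) M.s₁ r π →
            M.IsEpsOptimal ε r (TabularRF.DetPolicy.toPolicy π)} ∧
      alg.deployments = H ∧
      (alg.trajectories : ℝ) ≤
        100001 * ((Fintype.card S : ℝ) ^ 2 * Fintype.card A * (H : ℝ) ^ 5 / ε ^ 2) *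
          Real.log ((Fintype.card S : ℝ) * Fintype.card A * H / (ε * δ)) ^ 3 := by
  have hdm : 0 < M.dm := pos_of_mul_pos_right (by linarith) (Nat.cast_nonneg H)
  obtain ⟨hH, _⟩ := M.pos_and_nonempty_of_dm_pos hdm
  have hS : 0 < Fintype.card S := Fintype.card_pos_iff.2 ⟨M.s₁⟩
  have hA : 0 < Fintype.card A := Fintype.card_pos
  have hη : 0 < ε / H := by positivity
  have hηdm : 5 * (ε / H) ≤ M.dm := by rw [mul_div_assoc', div_le_iff₀ (by positivity)]; linarith
  have hη1 : ε / H ≤ 1 / 4 := by linarith [M.dm_le_one]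
  have hι := TabularRF.one_le_iota hS hA hH hε hδ hδ1 hη1
  have hι0 := zero_lt_one.trans_le hι
  rw [TabularRF.threshold_one_one hS hH hι0] at halg
  refine ⟨?_, rfl, ?_⟩
  · have hprob := halg.one_sub_le_prob_of_batch hH hη hηdm hδ hδ1 hι
      (TabularRF.exp_iota hS hA hH hε hδ)
      (TabularRF.mul_le_batchSize_mul_sq 100000 hS hH hε hι0)
    rwa [mul_div_cancel₀ ε (by positivity)] at hprob
  · simp only [TabularRF.Scheme.trajectories, Fintype.card_prod, Fintype.card_fin, Nat.cast_mul]
    exact TabularRF.horizon_mul_batchSize_le (C₂ := 100000) (C := 100001) (by norm_num)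
      (by norm_num) hS hA hH hε (by linarith) hι

theorem theoremH1 :
    ∃ C₁ C₂ C₃ C₄ C : ℝ, 0 < C₁ ∧ 0 < C₂ ∧ 0 < C₃ ∧ 0 < C₄ ∧ 0 < C ∧
      ∀ (S A : Type*) [Fintype S] [DecidableEq S] [Fintype A] [DecidableEq A] (H : ℕ)
        (M : TabularRF.MDP S A H) (ε δ : ℝ),
        0 < M.dm → 0 < ε → 0 < δ → δ < 1 →
        ε ≤ H * M.dm / (C₄ * Fintype.card S * Fintype.card A) →
        ∀ alg : TabularRF.Scheme S A H H
            (TabularRF.batchSize C₁ C₂ (Fintype.card S) (Fintype.card A) H ε δ),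
          alg.IsLayerwiseExploration M.s₁
            (TabularRF.threshold C₁ C₃ (Fintype.card S) (Fintype.card A) H ε δ) →
          1 - δ ≤ alg.prob M
              {D | ∀ r : TabularRF.Reward S A H, TabularRF.IsValidReward r →
                ∀ π : TabularRF.DetPolicy S A H,
                  TabularRF.IsPlanningOutput (TabularRF.pool D) M.s₁ r π →
                    M.IsEpsOptimal ε r (TabularRF.DetPolicy.toPolicy π)} ∧
            alg.deployments = H ∧
            (alg.trajectories : ℝ) ≤
              C * ((Fintype.card S : ℝ) ^ 2 * Fintype.card A * (H : ℝ) ^ 5 / ε ^ 2) *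
                Real.log ((Fintype.card S : ℝ) * Fintype.card A * H / (ε * δ)) ^ 3 := by
  refine ⟨1, 100000, 1, 5, 100001, one_pos, by norm_num, one_pos, by norm_num, by norm_num, ?_⟩
  intro S A _ _ _ _ H M ε δ hdm hε hδ hδ1 hεdm alg halg
  have := (M.pos_and_nonempty_of_dm_pos hdm).2
  have hSA : (1 : ℝ) ≤ Fintype.card S * Fintype.card A := by
    exact_mod_cast Nat.mul_pos (Fintype.card_pos_iff.2 ⟨M.s₁⟩) Fintype.card_pos
  rw [mul_assoc, ← div_div] at hεdm
  exact theoremH1_general M hε hδ hδ1.le (hεdm.trans (div_le_self (by positivity) hSA)) alg halg
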